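/- **Setting.** Let $\mathcal U$ be one of the categories $\mathbf{Set}$, $\mathbf{Top}$, $\mathbf{Haus}$, and $\mathcal T$ a class of test spaces, i.e. of (locally convex) subsets of Euclidean spaces with the $C^\infty$-maps between them (all derivatives exist and are continuous on the whole set). A *virtual object* $(X,I,O)$ is an object $X$ of $\mathcal U$ with families of input test maps $I(T)\subseteq\mathcal U(T,X)$ and output test maps $O(T)\subseteq\mathcal U(X,T)$, $T\in\mathcal T$, stable under composition with smooth maps between test spaces and such that $o\circ i$ is smooth for all $i\in I$, $o\in O$. A morphism is a $\mathcal U$-morphism $f$ with $f\circ I\subseteq I'$ and $O'\circ f\subseteq O$. On one $X$, write $(I,O)\le(I',O')$ if the identity is a morphism. Forcing conditions: * $\mathrm{Sat}$: a $\mathcal U$-morphism from (to) a test space belongs to $I$ (to $O$) if all its composites with $O$ (with $I$) are smooth; * $\mathrm{Sheaf}$: it belongs to the family if it does so locally (on the input side: on relatively open pieces of the test space that are again test spaces; on the output side, over $\mathbf{Top}$: near every point of $X$ it agrees with a member of $O$); * $\mathrm{Term}$: all $\mathcal U$-morphisms from (to) a terminal test space belong to the family; * input $\mathrm{Det}$: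 $i\colon T\to X$ is in $I$ if $i\circ t_\lambda\in I$ for all members of some family of smooth maps $t_\lambda\colon T_\lambda\to T$ that detects smoothness of $\mathcal U$-morphisms from $T$ to test spaces; output $\mathrm{Det}$: $o\colon X\to\mathbb R^n$ is in $O$ if its coordinates are. Write $(\mathcal U,\mathcal T,(\text{input condition},\text{output condition}))$ for the full subcategory of virtual objects satisfying the conditions, and $\mathbb R$, $\mathrm{Eucl}$, $\mathrm{Op}$, $\mathrm{Conv}$, $\mathrm{ClConv}$ for the test classes consisting of the real line only, of all Euclidean spaces, and of all open, all convex, all closed convex subsets of Euclidean spaces. Put * $\mathrm{Fr\ddot olicher}=(\mathbf{Set},\mathbb R,(\mathrm{Sat},\mathrm{Sat}))$, $\mathrm{Smith}=(\mathbf{Top},\mathbb R,(\mathrm{Sat},\mathrm{Sat}))$; * $\mathrm{Souriau}=(\mathbf{Set},\mathrm{Op},(\mathrm{Sheaf}\,\mathrm{Term},\mathrm{Sat}))$, $\mathrm{Chen}=(\mathbf{Set},\mathrm{Conv},(\mathrm{Sheaf}\,\mathrm{Term},\mathrm{Sat}))$; * $\mathrm{Sikorski}=(\mathbf{Top},\mathrm{Eucl},(\mathrm{Sat},\mathrm{Sheaf}\,\mathrm{Det}\,\mathrm{Term}))$;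 * $\mathrm{Chen}_{73}=(\mathbf{Haus},\mathrm{ClConv},(\mathrm{Term},\mathrm{Sat}))$, $\mathrm{Chen}_{75a}=(\mathbf{Top},\mathrm{ClConv},(\mathrm{Term},\mathrm{Sat}))$, $\mathrm{Chen}_{75b}=(\mathbf{Top},\mathrm{ClConv},(\mathrm{Det}\,\mathrm{Term},\mathrm{Sat}))$. For test classes $\mathcal S\subseteq\mathcal T$, restriction keeps the test maps for $\mathcal S$. On each $X$, the join extension of $V$ is the join of all structures whose restriction is $\le V$, and the meet extension is the meet of all structures whose restriction is $\ge V$ (joins and meets among the structures on $X$ that satisfy the conditions of the target category). When only the conditions change and $\mathcal T$ is fixed, these are the join and meet forcing functors. **Theorem.** 1. Restriction is an isomorphism of categories $(\mathbf{Set},\mathrm{Op},(\mathrm{Sat},\mathrm{Sat}))\cong\mathrm{Fr\ddot olicher}$, $(\mathbf{Top},\mathrm{Eucl},(\mathrm{Sat},\mathrm{Sat}))\cong\mathrm{Smith}$ and $\mathrm{Souriau}\cong(\mathbf{Set},\mathrm{Op}\cap\mathrm{Conv},(\mathrm{Sheaf}\,\mathrm{Term},\mathrm{Sat}))$; the inverse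 is extension, the join and the meet extension being equal. 2. Via 1, inclusion is a full embedding $\mathrm{Fr\ddot olicher}\to\mathrm{Souriau}$ with a left adjoint, given by the meet forcing functor. 3. Restriction to $\mathrm{Op}\cap\mathrm{Conv}$ followed by the inverse of the third isomorphism in 1 is a functor $\mathrm{Chen}\to\mathrm{Souriau}$ with both a left and a right adjoint; the left adjoint is given by the meet extension, the right adjoint by the join extension, and both adjoints are full embeddings $\mathrm{Souriau}\to\mathrm{Chen}$. 4. Via 1, inclusion is a full embedding $\mathrm{Smith}\to\mathrm{Sikorski}$ with a right adjoint, given by the join forcing functor. 5. Equipping a Frölicher space with the finest topology making its curves continuous, or with the coarsest topology making its functionals continuous, gives two full embeddings $\mathrm{Fr\ddot olicher}\to\mathrm{Smith}$. Both have as left inverse the functor $\mathrm{Smith}\to\mathrm{Fr\ddot olicher}$ which takes as curves all maps $c\colon\mathbb R\to X$, continuous or not, with $f\circ c$ smooth for all functionals $f$ of the Smith space, and as functionals all maps $X\to\mathbb R$ whose composites with these curves are smooth. 6. The inclusions $\mathrm{Chen}_{73}\to\mathrm{Chen}_{75a}$ and $\mathrm{Chen}_{75b}\to\mathrm{Chen}_{75a}$,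 and the join extension $\mathrm{Smith}\to\mathrm{Chen}_{75b}$, are full embeddings with left adjoints. -/

import Mathlib

open CategoryTheory
open scoped ContDiff

universe u

namespace SmoothSpaces

/-! ### Test spaces and smooth maps between them -/

/-- The Euclidean space `ℝⁿ`. -/
abbrev Euc (n : ℕ) : Type := EuclideanSpace ℝ (Fin n)

/-- A test space: a subset of some Euclidean space. -/
structure TestSpace where
  dim : ℕ
  carrier : Set (Euc dim)

instance : CoeSort TestSpace Type := ⟨fun S => S.carrier⟩

/-- Smooth maps between (locally convex) subsets of Euclidean spaces: on the source, all
derivatives exist and are continuous up to the boundary. -/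
def IsSmooth {S T : TestSpace} (f : S → T) : Prop :=
  ∃ g : Euc S.dim → Euc T.dim, ContDiffOn ℝ ∞ g S.carrier ∧ ∀ x : S, g x = f x

theorem IsSmooth.continuous {S T : TestSpace} {f : S → T} (hf : IsSmooth f) : Continuous f := by
  obtain ⟨g, hg, h⟩ := hf
  refine continuous_induced_rng.2 ?_
  have h1 : ((fun y : T => (y : Euc T.dim)) ∘ f) = S.carrier.domRestrict g := by
    funext x
    exact (h x).symm
  exact h1 ▸ continuousOn_iff_continuous_domRestrict.1 hg.continuousOn

theorem IsSmooth.comp {S T R : TestSpace} {g : T → R} {f : S → T} (hg : IsSmooth g)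
    (hf : IsSmooth f) : IsSmooth (g ∘ f) := by
  obtain ⟨g', hg, h⟩ := hg
  obtain ⟨f', hf, k⟩ := hf
  refine ⟨g' ∘ f', hg.comp hf fun x hx => ?_, fun x => ?_⟩
  · rw [k ⟨x, hx⟩]
    exact (f ⟨x, hx⟩).2
  · simp [k, h]

/-- The part of the test space `S` that lies in `U`. -/
def TestSpace.cut (S : TestSpace) (U : Set (Euc S.dim)) : TestSpace := ⟨S.dim, S.carrier ∩ U⟩

/-- The real line as a test space (as the one-dimensional Euclidean space). -/
def realLine : TestSpace := ⟨1, Set.univ⟩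

/-- The test category with the single object `ℝ`. -/
def lineTests : Set TestSpace := {realLine}

/-- All Euclidean spaces. -/
def euclideanTests : Set TestSpace := {S | S.carrier = Set.univ}

/-- All open subsets of Euclidean spaces. -/
def openTests : Set TestSpace := {S | IsOpen S.carrier}

/-- All convex subsets of Euclidean spaces. -/
def convexTests : Set TestSpace := {S | Convex ℝ S.carrier}

/-- All closed convex subsets of Euclidean spaces. -/
def closedConvexTests : Set TestSpace := {S | IsClosed S.carrier ∧ Convex ℝ S.carrier}

/-- `S` is a terminal object of the test category `𝒯`. -/
def IsTerminalTest (𝒯 : Set TestSpace) (S : TestSpace) : Prop :=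
  ∀ T ∈ 𝒯, ∃! f : T → S, IsSmooth f

/-- The coordinate projection `ℝⁿ → ℝ`, restricted to a test space. -/
noncomputable def coordinate (S : TestSpace) (j : Fin S.dim) (x : S) : realLine :=
  ⟨WithLp.toLp 2 (fun _ => (x : Euc S.dim) j), Set.mem_univ _⟩

/-! ### Underlying categories -/

/-- A category of sets with structure (below: sets, topological spaces, Hausdorff spaces) in
which every test space is an object; `inMor b S` and `outMor b S` are the morphisms from, and to,
the test space `S`, and `testMor S T` are the morphisms between two test spaces. -/
structure Underlying where
  Str : Type u → Type u
  mor : ∀ {X Y : Type u}, Str X → Str Y → Set (X → Y)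
  inMor : ∀ {X : Type u}, Str X → ∀ S : TestSpace, Set (S → X)
  outMor : ∀ {X : Type u}, Str X → ∀ S : TestSpace, Set (X → S)
  testMor : ∀ S T : TestSpace, Set (S → T)
  id_mor : ∀ {X : Type u} (b : Str X), id ∈ mor b b
  comp_mor : ∀ {X Y Z : Type u} {b : Str X} {c : Str Y} {d : Str Z} {f : X → Y} {g : Y → Z},
    f ∈ mor b c → g ∈ mor c d → g ∘ f ∈ mor b d

/-- Sets and all maps. -/
def sets : Underlying.{u} where
  Str _ := PUnit
  mor _ _ := Set.univ
  inMor _ _ := Set.univ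
  outMor _ _ := Set.univ
  testMor _ _ := Set.univ
  id_mor _ := trivial
  comp_mor _ _ := trivial

/-- Topological spaces and continuous maps. -/
def topologicalSpaces : Underlying.{u} where
  Str X := TopologicalSpace X
  mor b c := {f | @Continuous _ _ b c f}
  inMor b _ := {i | @Continuous _ _ _ b i}
  outMor b _ := {o | @Continuous _ _ b _ o}
  testMor _ _ := {f | Continuous f}
  id_mor b := @continuous_id _ b
  comp_mor {_ _ _ b c d _ _} hf hg := @Continuous.comp _ _ _ b c d _ _ hg hf

/-- Hausdorff topological spaces and continuous maps. -/
def hausdorffSpaces : Underlying.{u} where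
  Str X := {b : TopologicalSpace X // @T2Space X b}
  mor b c := {f | @Continuous _ _ b.1 c.1 f}
  inMor b _ := {i | @Continuous _ _ _ b.1 i}
  outMor b _ := {o | @Continuous _ _ b.1 _ o}
  testMor _ _ := {f | Continuous f}
  id_mor b := @continuous_id _ b.1
  comp_mor {_ _ _ b c d _ _} hf hg := @Continuous.comp _ _ _ b.1 c.1 d.1 _ _ hg hf

/-! ### Families of test maps -/

/-- Families of input test maps `S → X` and output test maps `X → S`, for `S` in the test category
`𝒯`, which are stable under composition with smooth maps between test spaces and compatible:
an input followed by an output is smooth. -/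
@[ext]
structure VirtualStr (B : Underlying.{u}) (𝒯 : Set TestSpace) {X : Type u} (b : B.Str X) where
  inp : ∀ S : 𝒯, Set (S.1 → X)
  out : ∀ S : 𝒯, Set (X → S.1)
  inp_mor : ∀ S, inp S ⊆ B.inMor b S.1
  out_mor : ∀ S, out S ⊆ B.outMor b S.1
  inp_comp : ∀ {S T : 𝒯} {f : S.1 → T.1} {i : T.1 → X}, IsSmooth f → i ∈ inp T → i ∘ f ∈ inp S
  out_comp : ∀ {S T : 𝒯} {f : S.1 → T.1} {o : X → S.1}, IsSmooth f → o ∈ out S → f ∘ o ∈ out T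
  compat : ∀ {S T : 𝒯} {i : S.1 → X} {o : X → T.1}, i ∈ inp S → o ∈ out T → IsSmooth (o ∘ i)

section

variable {B : Underlying.{u}} {𝒮 𝒯 : Set TestSpace}

/-- `V ≤ W` when the identity map is a morphism from `V` to `W`. -/
instance {X : Type u} (b : B.Str X) : PartialOrder (VirtualStr B 𝒯 b) where
  le V W := (∀ S, V.inp S ⊆ W.inp S) ∧ ∀ S, W.out S ⊆ V.out S
  le_refl V := ⟨fun _ => subset_rfl, fun _ => subset_rfl⟩
  le_trans _ _ _ h k := ⟨fun S => (h.1 S).trans (k.1 S), fun S => (k.2 S).trans (h.2 S)⟩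
  le_antisymm _ _ h k := VirtualStr.ext (funext fun S => (h.1 S).antisymm (k.1 S))
    (funext fun S => (k.2 S).antisymm (h.2 S))

/-- Restriction of both families of test maps to a smaller test category. -/
def VirtualStr.restrict (h : 𝒮 ⊆ 𝒯) {X : Type u} {b : B.Str X} (V : VirtualStr B 𝒯 b) :
    VirtualStr B 𝒮 b where
  inp S := V.inp ⟨S.1, h S.2⟩
  out S := V.out ⟨S.1, h S.2⟩
  inp_mor _ := V.inp_mor _
  out_mor _ := V.out_mor _
  inp_comp hf hi := V.inp_comp hf hi
  out_comp hf ho := V.out_comp hf ho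
  compat hi ho := V.compat hi ho

/-- `f` underlies a morphism: it is a morphism of the underlying category, it takes input test maps
to input test maps, and it pulls output test maps back to output test maps. -/
def IsMor {X Y : Type u} {b : B.Str X} {c : B.Str Y}
    (V : VirtualStr B 𝒯 b) (W : VirtualStr B 𝒯 c) (f : X → Y) : Prop :=
  f ∈ B.mor b c ∧ (∀ S, ∀ i ∈ V.inp S, f ∘ i ∈ W.inp S) ∧ ∀ S, ∀ o ∈ W.out S, o ∘ f ∈ V.out S

/-! ### Forcing conditions -/

/-- A condition on families of test maps; conditions are combined with `⊓`. -/
abbrev Condition (B : Underlying.{u}) (𝒯 : Set TestSpace) :=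
  ∀ ⦃X : Type u⦄ (b : B.Str X), VirtualStr B 𝒯 b → Prop

/-- Input saturation: a morphism from a test space is an input as soon as its composites with all
outputs are smooth. -/
def InSat : Condition B 𝒯 := fun X b V =>
  ∀ (S : 𝒯) (i : S.1 → X), i ∈ B.inMor b S.1 →
    (∀ T, ∀ o ∈ V.out T, IsSmooth (o ∘ i)) → i ∈ V.inp S

/-- Output saturation. -/
def OutSat : Condition B 𝒯 := fun X b V =>
  ∀ (T : 𝒯) (o : X → T.1), o ∈ B.outMor b T.1 →
    (∀ S, ∀ i ∈ V.inp S, IsSmooth (o ∘ i)) → o ∈ V.out T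

/-- The input sheaf condition: a morphism from a test space which is an input near every point
(on a relatively open subset that is again a test space) is an input. -/
def InSheaf : Condition B 𝒯 := fun X b V =>
  ∀ (S : 𝒯) (i : S.1 → X), i ∈ B.inMor b S.1 →
    (∀ x : S.1, ∃ U : Set (Euc S.1.dim), IsOpen U ∧ (x : Euc S.1.dim) ∈ U ∧
      ∃ h : S.1.cut U ∈ 𝒯, (fun y : S.1.cut U => i ⟨y.1, y.2.1⟩) ∈ V.inp ⟨S.1.cut U, h⟩) →
    i ∈ V.inp S

/-- The output sheaf condition, over topological spaces: a continuous map which agrees with an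
output near every point is an output. -/
def OutSheaf : Condition topologicalSpaces.{u} 𝒯 := fun X b V =>
  ∀ (T : 𝒯) (o : X → T.1), o ∈ topologicalSpaces.outMor b T.1 →
    (∀ x : X, ∃ U : Set X, @IsOpen X b U ∧ x ∈ U ∧ ∃ g ∈ V.out T, ∀ y ∈ U, o y = g y) →
    o ∈ V.out T

/-- The input terminal condition: all morphisms from a terminal test space are inputs. -/
def InTerm : Condition B 𝒯 := fun _ b V =>
  ∀ S : 𝒯, IsTerminalTest 𝒯 S.1 → B.inMor b S.1 ⊆ V.inp S

/-- The output terminal condition: all morphisms to a terminal test space are outputs. -/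
def OutTerm : Condition B 𝒯 := fun _ b V =>
  ∀ T : 𝒯, IsTerminalTest 𝒯 T.1 → B.outMor b T.1 ⊆ V.out T

/-- A family of smooth maps into the test space `S` is determining when a morphism from `S` to a
test space is smooth as soon as its composites with the members of the family are smooth. -/
def IsDetermining (B : Underlying.{u}) (𝒯 : Set TestSpace) (S : TestSpace)
    (F : ∀ T : 𝒯, Set (T.1 → S)) : Prop :=
  (∀ T, ∀ t ∈ F T, IsSmooth t) ∧
    ∀ (S' : 𝒯) (f : S → S'.1), f ∈ B.testMor S S'.1 →
      (∀ T, ∀ t ∈ F T, IsSmooth (f ∘ t)) → IsSmooth f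

/-- The input determined condition: a morphism from a test space is an input as soon as its
composites with the members of some determining family are inputs. -/
def InDet : Condition B 𝒯 := fun X b V =>
  ∀ (S : 𝒯) (F : ∀ T : 𝒯, Set (T.1 → S.1)), IsDetermining B 𝒯 S.1 F →
    ∀ i : S.1 → X, i ∈ B.inMor b S.1 → (∀ T, ∀ t ∈ F T, i ∘ t ∈ V.inp T) → i ∈ V.inp S

/-- The output specifically determined condition, for the families of coordinate projections: a
morphism to a test space is an output as soon as its coordinates are outputs. -/
def OutDetCoord (h : lineTests ⊆ 𝒯) : Condition B 𝒯 := fun X b V =>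
  ∀ (T : 𝒯) (o : X → T.1), o ∈ B.outMor b T.1 →
    (∀ j, coordinate T.1 j ∘ o ∈ V.out ⟨realLine, h (Set.mem_singleton _)⟩) → o ∈ V.out T

/-! ### Categories of smooth spaces -/

/-- An object of the underlying category with families of test maps satisfying the condition. -/
structure Space (P : Condition B 𝒯) where
  carrier : Type u
  base : B.Str carrier
  str : VirtualStr B 𝒯 base
  prop : P base str

@[ext]
structure Space.Hom {P : Condition B 𝒯} (A A' : Space P) where
  toFun : A.carrier → A'.carrier
  isMor : IsMor A.str A'.str toFun

instance (P : Condition B 𝒯) : Category (Space P) where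
  Hom := Space.Hom
  id A := ⟨id, B.id_mor _, fun _ _ h => h, fun _ _ h => h⟩
  comp f g := ⟨g.toFun ∘ f.toFun, B.comp_mor f.isMor.1 g.isMor.1,
    fun S _ hi => g.isMor.2.1 S _ (f.isMor.2.1 S _ hi),
    fun S _ ho => f.isMor.2.2 S _ (g.isMor.2.2 S _ ho)⟩

/-- A functor which only changes the test maps: it preserves the underlying objects and the
underlying maps of morphisms. -/
structure FibreFunctor (P : Condition B 𝒯) (Q : Condition B 𝒮) where
  obj : ∀ ⦃X : Type u⦄ (b : B.Str X), {V : VirtualStr B 𝒯 b // P b V} →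
    {W : VirtualStr B 𝒮 b // Q b W}
  map : ∀ ⦃X Y : Type u⦄ (b : B.Str X) (c : B.Str Y) (V : {V : VirtualStr B 𝒯 b // P b V})
    (W : {W : VirtualStr B 𝒯 c // P c W}) (f : X → Y),
    IsMor V.1 W.1 f → IsMor (obj b V).1 (obj c W).1 f

namespace FibreFunctor

variable {P : Condition B 𝒯} {Q : Condition B 𝒮}

def functor (F : FibreFunctor P Q) : Space P ⥤ Space Q where
  obj A := ⟨A.carrier, A.base, (F.obj A.base ⟨A.str, A.prop⟩).1, (F.obj A.base ⟨A.str, A.prop⟩).2⟩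
  map {A A'} f := ⟨f.toFun, F.map A.base A'.base ⟨A.str, A.prop⟩ ⟨A'.str, A'.prop⟩ _ f.isMor⟩
  map_id _ := rfl
  map_comp _ _ := rfl

/-- The functor restricts the test maps to the smaller test category. -/
def IsRestriction (F : FibreFunctor P Q) (h : 𝒮 ⊆ 𝒯) : Prop :=
  ∀ (X : Type u) (b : B.Str X) (V), (F.obj b V).1 = V.1.restrict h

/-- The functor takes `V` to the join of all structures whose restriction lies below `V`. -/
def IsJoinExtension (F : FibreFunctor P Q) (h : 𝒯 ⊆ 𝒮) : Prop :=
  ∀ (X : Type u) (b : B.Str X) (V),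
    IsLUB {W : {W : VirtualStr B 𝒮 b // Q b W} | W.1.restrict h ≤ V.1} (F.obj b V)

/-- The functor takes `V` to the meet of all structures whose restriction lies above `V`. -/
def IsMeetExtension (F : FibreFunctor P Q) (h : 𝒯 ⊆ 𝒮) : Prop :=
  ∀ (X : Type u) (b : B.Str X) (V),
    IsGLB {W : {W : VirtualStr B 𝒮 b // Q b W} | V.1 ≤ W.1.restrict h} (F.obj b V)

/-- The functor is the inclusion between two full subcategories defined by conditions. -/
def IsInclusion {Q : Condition B 𝒯} (F : FibreFunctor P Q) : Prop :=
  ∀ (X : Type u) (b : B.Str X) (V), (F.obj b V).1 = V.1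

/-- The forcing functor which takes `V` to the join of all structures below `V`. -/
def IsJoinForcing {Q : Condition B 𝒯} (F : FibreFunctor P Q) : Prop :=
  ∀ (X : Type u) (b : B.Str X) (V),
    IsLUB {W : {W : VirtualStr B 𝒯 b // Q b W} | W.1 ≤ V.1} (F.obj b V)

/-- The forcing functor which takes `V` to the meet of all structures above `V`. -/
def IsMeetForcing {Q : Condition B 𝒯} (F : FibreFunctor P Q) : Prop :=
  ∀ (X : Type u) (b : B.Str X) (V),
    IsGLB {W : {W : VirtualStr B 𝒯 b // Q b W} | V.1 ≤ W.1} (F.obj b V)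

/-- The functors are mutually inverse, and the second is both the join and the meet extension
along the restriction functor given by the first. -/
def IsRestrictionExtensionIso (R : FibreFunctor P Q) (E : FibreFunctor Q P) (h : 𝒮 ⊆ 𝒯) : Prop :=
  R.IsRestriction h ∧ E.IsJoinExtension h ∧ E.IsMeetExtension h ∧
    R.functor ⋙ E.functor = 𝟭 (Space P) ∧ E.functor ⋙ R.functor = 𝟭 (Space Q)

end FibreFunctor

end

theorem line_subset_open : lineTests ⊆ openTests := by
  rintro _ rfl; exact (isOpen_univ : IsOpen (Set.univ : Set (Euc 1)))

theorem line_subset_euclidean : lineTests ⊆ euclideanTests := by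
  rintro _ rfl; rfl

theorem line_subset_closedConvex : lineTests ⊆ closedConvexTests := by
  rintro _ rfl; exact ⟨isClosed_univ, convex_univ⟩

/-- Frölicher spaces `(X, C, F)`. -/
def frolicher : Condition sets.{u} lineTests := InSat ⊓ OutSat

/-- The variant of Frölicher spaces with all open subsets of Euclidean spaces as test spaces. -/
def frolicherOpen : Condition sets.{u} openTests := InSat ⊓ OutSat

/-- Souriau (diffeological) spaces. -/
def souriau : Condition sets.{u} openTests := InSheaf ⊓ InTerm ⊓ OutSat

/-- The variant of Souriau spaces with only the open convex sets as test spaces. -/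
def souriauConvex : Condition sets.{u} (openTests ∩ convexTests) := InSheaf ⊓ InTerm ⊓ OutSat

/-- Chen spaces (final definition). -/
def chen : Condition sets.{u} convexTests := InSheaf ⊓ InTerm ⊓ OutSat

/-- Smith spaces. -/
def smith : Condition topologicalSpaces.{u} lineTests := InSat ⊓ OutSat

/-- The variant of Smith spaces with all Euclidean spaces as test spaces. -/
def smithEuclidean : Condition topologicalSpaces.{u} euclideanTests := InSat ⊓ OutSat

/-- Sikorski spaces. -/
def sikorski : Condition topologicalSpaces.{u} euclideanTests :=
  InSat ⊓ (OutSheaf ⊓ OutDetCoord line_subset_euclidean ⊓ OutTerm)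

/-- Chen spaces, first definition (1973). -/
def chen1973 : Condition hausdorffSpaces.{u} closedConvexTests := InTerm ⊓ OutSat

/-- Chen spaces, second definition (1975). -/
def chen1975a : Condition topologicalSpaces.{u} closedConvexTests := InTerm ⊓ OutSat

/-- Chen spaces, third definition (1975). -/
def chen1975b : Condition topologicalSpaces.{u} closedConvexTests := InDet ⊓ InTerm ⊓ OutSat

/-! ### Functors which change the underlying category -/

/-- The inclusion of Hausdorff spaces in topological spaces, on the level of Chen spaces. -/
def chen1973Inclusion : Space chen1973.{u} ⥤ Space chen1975a.{u} where
  obj A := {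
    carrier := A.carrier
    base := A.base.1
    str := {
      inp := A.str.inp
      out := A.str.out
      inp_mor := A.str.inp_mor
      out_mor := A.str.out_mor
      inp_comp := A.str.inp_comp
      out_comp := A.str.out_comp
      compat := A.str.compat }
    prop := A.prop }
  map f := ⟨f.toFun, f.isMor⟩

/-- A Frölicher space with a topology for which its curves and functionals are continuous is a
Smith space. -/
def Frolicher.withTopology (A : Space frolicher.{u}) (t : TopologicalSpace A.carrier)
    (hi : ∀ S, ∀ i ∈ A.str.inp S, @Continuous _ _ _ t i)
    (ho : ∀ S, ∀ o ∈ A.str.out S, @Continuous _ _ t _ o) : Space smith.{u} where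
  carrier := A.carrier
  base := t
  str := {
    inp := A.str.inp
    out := A.str.out
    inp_mor := hi
    out_mor := ho
    inp_comp := A.str.inp_comp
    out_comp := A.str.out_comp
    compat := A.str.compat }
  prop := ⟨fun S i _ h => A.prop.1 S i trivial h, fun T o _ h => A.prop.2 T o trivial h⟩

/-- The finest topology for which all smooth curves are continuous. -/
abbrev Frolicher.curvaceous (A : Space frolicher.{u}) : TopologicalSpace A.carrier :=
  ⨆ (S : lineTests) (i : A.str.inp S), TopologicalSpace.coinduced i.1 inferInstance

/-- The coarsest topology for which all smooth functionals are continuous. -/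
abbrev Frolicher.functional (A : Space frolicher.{u}) : TopologicalSpace A.carrier :=
  ⨅ (S : lineTests) (o : A.str.out S), TopologicalSpace.induced o.1 inferInstance

/-- Frölicher spaces as Smith spaces, with the curvaceous topology. -/
def frolicherToSmithCurvaceous : Space frolicher.{u} ⥤ Space smith.{u} where
  obj A := Frolicher.withTopology A (Frolicher.curvaceous A)
    (fun S i hi => continuous_iff_coinduced_le.2
      (le_iSup₂_of_le (f := fun (S : lineTests) (i : A.str.inp S) =>
        TopologicalSpace.coinduced i.1 inferInstance) S ⟨i, hi⟩ le_rfl))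
    (fun _ _ ho => continuous_iSup_dom.2 fun _ => continuous_iSup_dom.2 fun i =>
      continuous_coinduced_dom.2 (A.str.compat i.2 ho).continuous)
  map {A A'} f := ⟨f.toFun,
    continuous_iSup_dom.2 fun S => continuous_iSup_dom.2 fun i => continuous_coinduced_dom.2
      (continuous_iff_coinduced_le.2
        (le_iSup₂_of_le (f := fun (S : lineTests) (i : A'.str.inp S) =>
          TopologicalSpace.coinduced i.1 inferInstance) S ⟨_, f.isMor.2.1 S i.1 i.2⟩ le_rfl)),
    f.isMor.2⟩

/-- Frölicher spaces as Smith spaces, with the functional topology. -/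
def frolicherToSmithFunctional : Space frolicher.{u} ⥤ Space smith.{u} where
  obj A := Frolicher.withTopology A (Frolicher.functional A)
    (fun _ _ hi => continuous_iInf_rng.2 fun _ => continuous_iInf_rng.2 fun o =>
      continuous_induced_rng.2 (A.str.compat hi o.2).continuous)
    (fun S o ho => continuous_iff_le_induced.2
      (iInf₂_le_of_le (f := fun (S : lineTests) (o : A.str.out S) =>
        TopologicalSpace.induced o.1 inferInstance) S ⟨o, ho⟩ le_rfl))
  map {A A'} f := ⟨f.toFun,
    continuous_iInf_rng.2 fun S => continuous_iInf_rng.2 fun o => continuous_induced_rng.2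
      (continuous_iff_le_induced.2
        (iInf₂_le_of_le (f := fun (S : lineTests) (o : A.str.out S) =>
          TopologicalSpace.induced o.1 inferInstance) S ⟨_, f.isMor.2.2 S o.1 o.2⟩ le_rfl)),
    f.isMor.2⟩

/-- The Frölicher space of a Smith space: its curves are all (not necessarily continuous) maps
whose composites with the functionals of the Smith space are smooth, and its functionals are all
maps whose composites with these curves are smooth. -/
def smithToFrolicher : Space smith.{u} ⥤ Space frolicher.{u} where
  obj A := {
    carrier := A.carrier
    base := PUnit.unit
    str := {
      inp := fun S => {i | ∀ T, ∀ o ∈ A.str.out T, IsSmooth (o ∘ i)}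
      out := fun T => {o | ∀ (S : lineTests) (i : S.1 → A.carrier),
        (∀ T', ∀ o' ∈ A.str.out T', IsSmooth (o' ∘ i)) → IsSmooth (o ∘ i)}
      inp_mor := fun _ _ _ => trivial
      out_mor := fun _ _ _ => trivial
      inp_comp := fun hf hi T o ho => (hi T o ho).comp hf
      out_comp := fun hf ho S i hi => hf.comp (ho S i hi)
      compat := fun hi ho => ho _ _ hi }
    prop := ⟨fun _ _ _ h T o ho => h T o fun _ _ hi => hi T o ho, fun _ _ _ h => h⟩ }
  map f := ⟨f.toFun, trivial, fun _ _ hi T o ho => hi T _ (f.isMor.2.2 T o ho),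
    fun _ _ ho S i hi => ho S _ fun T o' ho' => hi T _ (f.isMor.2.2 T o' ho')⟩

end SmoothSpaces

open SmoothSpaces

/-!
Boman's theorem, in the form needed here for maps on open or convex sets, says that a map is smooth
as soon as its composites with smooth curves are. Hence the inputs on the real line determine the
saturated structures on larger test categories: a map is an input or an output as soon as it becomes
one when probed by curves. On convex sets with empty interior or with boundary points, the theorem
holds because the difference quotients of a map which is smooth along curves stay bounded up to the
boundary (Kriegl). For sheaf conditions, probing by open convex sets gives the largest extension of
a structure, and the maps which factor locally through open convex sets give the smallest one.

All adjunctions between categories over the same underlying category have the identity as underlying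
map of the unit and the counit, so that they amount to inequalities `V ≤ G (F V)` and `F (G W) ≤ W`
between structures on the same object.
-/

namespace SmoothSpaces

/-! ### Curves through fast converging sequences -/

section CurveThrough

open Filter Topology Metric

/-- The points `2⁻ᵏ`, at which `curveThrough` meets the terms of a given sequence. -/
noncomputable def bumpCentre (k : ℕ) : ℝ := (1 / 2) ^ k

theorem bumpCentre_pos (k : ℕ) : 0 < bumpCentre k :=
  pow_pos one_half_pos k

theorem tendsto_bumpCentre : Tendsto bumpCentre atTop (𝓝 0) :=
  tendsto_pow_atTop_nhds_zero_of_lt_one one_half_pos.le one_half_lt_one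

theorem bumpCentre_le_half {j k : ℕ} (h : j < k) : bumpCentre k ≤ bumpCentre j / 2 :=
  (pow_le_pow_of_le_one one_half_pos.le one_half_lt_one.le h).trans_eq <| by
    rw [bumpCentre, pow_succ, mul_one_div]

/-- Bump functions around the points `2⁻ᵏ`, narrow enough to have disjoint supports. -/
noncomputable def separatedBump (k : ℕ) : ContDiffBump (bumpCentre k) where
  rIn := bumpCentre k / 8
  rOut := bumpCentre k / 4
  rIn_pos := div_pos (bumpCentre_pos k) (by norm_num)
  rIn_lt_rOut := div_lt_div_of_pos_left (bumpCentre_pos k) (by norm_num) (by norm_num)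

theorem mem_Ioo_of_separatedBump_ne_zero {k : ℕ} {t : ℝ} (h : separatedBump k t ≠ 0) :
    t ∈ Set.Ioo (3 / 4 * bumpCentre k) (5 / 4 * bumpCentre k) := by
  have ht : t ∈ ball (bumpCentre k) (bumpCentre k / 4) :=
    (separatedBump k).support_eq ▸ Function.mem_support.2 h
  rw [Real.ball_eq_Ioo] at ht
  exact ⟨by linarith [ht.1], by linarith [ht.2]⟩

theorem separatedBump_zero (k : ℕ) : separatedBump k 0 = 0 := by
  by_contra h
  linarith [bumpCentre_pos k, (mem_Ioo_of_separatedBump_ne_zero h).1]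

theorem separatedBump_eq_zero_of_ne {j k : ℕ} {t : ℝ} (hk : separatedBump k t ≠ 0) (h : j ≠ k) :
    separatedBump j t = 0 := by
  by_contra hj
  obtain ⟨hk₁, hk₂⟩ := mem_Ioo_of_separatedBump_ne_zero hk
  obtain ⟨hj₁, hj₂⟩ := mem_Ioo_of_separatedBump_ne_zero hj
  rcases h.lt_or_gt with h | h <;>
    linarith [bumpCentre_le_half h, bumpCentre_pos j, bumpCentre_pos k]

theorem contDiff_separatedBump_mul_sub (k : ℕ) :
    ContDiff ℝ ∞ fun t => separatedBump k t * (t - bumpCentre k) :=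
  (separatedBump k).contDiff.mul (contDiff_id.sub contDiff_const)

theorem exists_forall_norm_iteratedFDeriv_le {E F : Type*} [NormedAddCommGroup E]
    [NormedSpace ℝ E] [NormedAddCommGroup F] [NormedSpace ℝ F] {f : E → F}
    (hf : ContDiff ℝ ∞ f) (hc : HasCompactSupport f) (k : ℕ) :
    ∃ M, ∀ i ≤ k, ∀ x, ‖iteratedFDeriv ℝ i f x‖ ≤ M :=
  ⟨_, fun i hi x => by
    simpa only [pow_zero, one_mul] using! SchwartzMap.one_add_le_sup_seminorm_apply (𝕜 := ℝ)
      (m := (0, k)) le_rfl hi (hc.toSchwartzMap hf) x⟩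

theorem exists_pos_mul_iteratedFDeriv_separatedBump_le (k : ℕ) :
    ∃ δ > 0, ∀ i ≤ k, ∀ t, δ * (‖iteratedFDeriv ℝ i (separatedBump k) t‖ +
      ‖iteratedFDeriv ℝ i (fun t => separatedBump k t * (t - bumpCentre k)) t‖) ≤ (1 / 2) ^ k := by
  obtain ⟨M, hM⟩ := exists_forall_norm_iteratedFDeriv_le (separatedBump k).contDiff
    (separatedBump k).hasCompactSupport k
  obtain ⟨N, hN⟩ := exists_forall_norm_iteratedFDeriv_le (contDiff_separatedBump_mul_sub k)
    (separatedBump k).hasCompactSupport.mul_right k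
  have hM0 : 0 ≤ M := (norm_nonneg _).trans (hM 0 k.zero_le 0)
  have hN0 : 0 ≤ N := (norm_nonneg _).trans (hN 0 k.zero_le 0)
  refine ⟨(1 / 2) ^ k / (M + N + 1), by positivity, fun i hi t => ?_⟩
  rw [div_mul_eq_mul_div, div_le_iff₀ (by positivity)]
  exact mul_le_mul_of_nonneg_left (by linarith [hM i hi t, hN i hi t]) (by positivity)

/-- How small the `k`-th terms of two sequences have to be for `curveThrough` to be smooth. -/
noncomputable def curveRadius (k : ℕ) : ℝ :=
  (exists_pos_mul_iteratedFDeriv_separatedBump_le k).choose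

theorem curveRadius_pos (k : ℕ) : 0 < curveRadius k :=
  (exists_pos_mul_iteratedFDeriv_separatedBump_le k).choose_spec.1

theorem curveRadius_mul_iteratedFDeriv_le {i k : ℕ} (h : i ≤ k) (t : ℝ) :
    curveRadius k * (‖iteratedFDeriv ℝ i (separatedBump k) t‖ +
      ‖iteratedFDeriv ℝ i (fun t => separatedBump k t * (t - bumpCentre k)) t‖) ≤ (1 / 2) ^ k :=
  (exists_pos_mul_iteratedFDeriv_separatedBump_le k).choose_spec.2 i h t

variable {E : Type*} [NormedAddCommGroup E] [NormedSpace ℝ E] {a b : ℕ → E}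

theorem norm_iteratedFDeriv_smul_const_le {φ : ℝ → ℝ} (hφ : ContDiff ℝ ∞ φ) (v : E) (i : ℕ)
    (t : ℝ) : ‖iteratedFDeriv ℝ i (fun s => φ s • v) t‖ ≤ ‖v‖ * ‖iteratedFDeriv ℝ i φ t‖ := by
  simpa only [ContinuousLinearMap.norm_toSpanSingleton] using!
    (ContinuousLinearMap.toSpanSingleton ℝ v).norm_iteratedFDeriv_comp_left
      (hφ.contDiffAt (x := t)) (n := i) (mod_cast le_top)

/-- The part of `curveThrough a b` near `2⁻ᵏ`. -/
noncomputable def curveTerm (a b : ℕ → E) (k : ℕ) (t : ℝ) : E :=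
  separatedBump k t • a k + (separatedBump k t * (t - bumpCentre k)) • b k

/-- The curve which is `a k + (t - 2⁻ᵏ) • b k` for `t` near `2⁻ᵏ`. It is smooth if the sequences
`a` and `b` converge to `0` fast enough. -/
noncomputable def curveThrough (a b : ℕ → E) (t : ℝ) : E := ∑' k, curveTerm a b k t

theorem curveTerm_of_separatedBump_eq_zero {k : ℕ} {t : ℝ} (h : separatedBump k t = 0) :
    curveTerm a b k t = 0 := by
  simp [curveTerm, h]

theorem curveThrough_eq_curveTerm {k : ℕ} {t : ℝ} (h : separatedBump k t ≠ 0) :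
    curveThrough a b t = curveTerm a b k t :=
  tsum_eq_single k fun _ hj =>
    curveTerm_of_separatedBump_eq_zero (separatedBump_eq_zero_of_ne h hj)

theorem curveThrough_eq_zero {t : ℝ} (h : ∀ k, separatedBump k t = 0) :
    curveThrough a b t = 0 := by
  simp [curveThrough, curveTerm_of_separatedBump_eq_zero (h _)]

theorem curveThrough_zero : curveThrough a b 0 = 0 :=
  curveThrough_eq_zero separatedBump_zero

theorem eventually_curveThrough_bumpCentre_add (a b : ℕ → E) (k : ℕ) :
    ∀ᶠ s in 𝓝 (0 : ℝ), curveThrough a b (bumpCentre k + s) = a k + s • b k := by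
  have hlim : Tendsto (fun s : ℝ => bumpCentre k + s) (𝓝 0) (𝓝 (bumpCentre k)) := by
    simpa using (continuous_const_add (bumpCentre k)).tendsto (0 : ℝ)
  filter_upwards [hlim.eventually (separatedBump k).eventuallyEq_one] with s hs
  rw [Pi.one_apply] at hs
  rw [curveThrough_eq_curveTerm (hs.symm ▸ one_ne_zero), curveTerm, hs]
  simp

theorem curveThrough_bumpCentre (a b : ℕ → E) (k : ℕ) :
    curveThrough a b (bumpCentre k) = a k := by
  simpa using (eventually_curveThrough_bumpCentre_add a b k).self_of_nhds

theorem exists_curveThrough_mem_segment (a : ℕ → E) (t : ℝ) :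
    ∃ k, curveThrough a 0 t ∈ segment ℝ 0 (a k) := by
  by_cases! h : ∃ k, separatedBump k t ≠ 0
  · obtain ⟨k, hk⟩ := h
    refine ⟨k, 1 - separatedBump k t, separatedBump k t, sub_nonneg.2 (separatedBump k).le_one,
      (separatedBump k).nonneg, sub_add_cancel _ _, ?_⟩
    simp [curveThrough_eq_curveTerm hk, curveTerm]
  · exact ⟨0, curveThrough_eq_zero (a := a) h ▸ left_mem_segment ℝ 0 (a 0)⟩

theorem norm_iteratedFDeriv_curveTerm_le {i k : ℕ} (h : i ≤ k) (ha : ‖a k‖ ≤ curveRadius k)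
    (hb : ‖b k‖ ≤ curveRadius k) (t : ℝ) :
    ‖iteratedFDeriv ℝ i (curveTerm a b k) t‖ ≤ (1 / 2) ^ k := by
  have hadd := iteratedFDeriv_add_apply (i := i) (x := t)
    (((separatedBump k).contDiff.smul (contDiff_const (c := a k))).contDiffAt)
    ((((contDiff_separatedBump_mul_sub k).smul (contDiff_const (c := b k))).of_le
      (mod_cast le_top)).contDiffAt)
  calc ‖iteratedFDeriv ℝ i (curveTerm a b k) t‖
      ≤ ‖a k‖ * ‖iteratedFDeriv ℝ i (separatedBump k) t‖ +
        ‖b k‖ * ‖iteratedFDeriv ℝ i (fun t => separatedBump k t * (t - bumpCentre k)) t‖ :=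
        (congrArg norm hadd).trans_le <| (norm_add_le _ _).trans <| add_le_add
          (norm_iteratedFDeriv_smul_const_le (separatedBump k).contDiff _ i t)
          (norm_iteratedFDeriv_smul_const_le (contDiff_separatedBump_mul_sub k) _ i t)
    _ ≤ curveRadius k * (‖iteratedFDeriv ℝ i (separatedBump k) t‖ +
        ‖iteratedFDeriv ℝ i (fun t => separatedBump k t * (t - bumpCentre k)) t‖) := by
        rw [mul_add]; gcongr
    _ ≤ (1 / 2) ^ k := curveRadius_mul_iteratedFDeriv_le h t

theorem contDiff_curveThrough [CompleteSpace E] (ha : ∀ k, ‖a k‖ ≤ curveRadius k)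
    (hb : ∀ k, ‖b k‖ ≤ curveRadius k) : ContDiff ℝ ∞ (curveThrough a b) := by
  refine contDiff_tsum_of_eventually (N := ⊤) (v := fun _ k => (1 / 2) ^ k)
    (fun k => ((separatedBump k).contDiff.smul contDiff_const).add
      ((contDiff_separatedBump_mul_sub k).smul contDiff_const))
    (fun _ _ => summable_geometric_two) fun i _ => ?_
  rw [Nat.cofinite_eq_atTop]
  filter_upwards [eventually_ge_atTop i] with k hk t
  exact norm_iteratedFDeriv_curveTerm_le hk (ha k) (hb k) t

end CurveThrough

/-! ### Functions which are smooth along smooth curves -/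

section SmoothAlongCurves

open Filter Topology Metric

variable {E F : Type*} [NormedAddCommGroup E] [NormedSpace ℝ E] [NormedAddCommGroup F]
  [NormedSpace ℝ F] {K : Set E} {f : E → F}

/-- `f` takes smooth curves in `K` to smooth curves. -/
def SmoothAlongCurves (K : Set E) (f : E → F) : Prop :=
  ∀ c : ℝ → E, ContDiff ℝ ∞ c → (∀ t, c t ∈ K) → ContDiff ℝ ∞ (f ∘ c)

theorem SmoothAlongCurves.continuousOn [CompleteSpace E] (hf : SmoothAlongCurves K f)
    (hK : Convex ℝ K) : ContinuousOn f K := by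
  intro x hx
  by_contra hcon
  rw [Metric.continuousWithinAt_iff] at hcon
  push Not at hcon
  obtain ⟨ε, hε, hfar⟩ := hcon
  choose y hyK hyx hyε using fun k => hfar (curveRadius k) (curveRadius_pos k)
  let c : ℝ → E := fun t => x + curveThrough (fun k => y k - x) 0 t
  have hcK (t : ℝ) : c t ∈ K := by
    obtain ⟨k, hk⟩ := exists_curveThrough_mem_segment (fun k => y k - x) t
    refine hK.segment_subset hx (hyK k) ?_
    simpa using (mem_segment_translate ℝ x).2 hk
  have hc : ContDiff ℝ ∞ c := contDiff_const.add <| contDiff_curveThrough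
    (fun k => (dist_eq_norm (y k) x ▸ hyx k).le)
    (fun k => by simpa using (curveRadius_pos k).le)
  have hlim : Tendsto (fun k => f (y k)) atTop (𝓝 (f x)) := by
    simpa [Function.comp_def, c, curveThrough_bumpCentre, curveThrough_zero] using
      ((hf c hc hcK).continuous.tendsto 0).comp tendsto_bumpCentre
  obtain ⟨k, hk⟩ := (Metric.tendsto_nhds.1 hlim ε hε).exists
  exact (hyε k).not_gt hk

/-- The `p`-th derivative of `f` at `x` in the direction `v`. -/
noncomputable def iteratedLineDeriv (f : E → F) (v : E) (p : ℕ) (x : E) : F :=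
  iteratedDeriv p (fun t : ℝ => f (x + t • v)) 0

theorem iteratedLineDeriv_zero (f : E → F) (v : E) : iteratedLineDeriv f v 0 = f := by
  funext x
  simp [iteratedLineDeriv]

theorem iteratedLineDeriv_add_smul (f : E → F) (v : E) (p : ℕ) (x : E) (t : ℝ) :
    iteratedLineDeriv f v p (x + t • v) = iteratedDeriv p (fun s : ℝ => f (x + s • v)) t := by
  have h := congrFun (iteratedDeriv_comp_const_add p (fun s : ℝ => f (x + s • v)) t) 0
  simpa only [iteratedLineDeriv, add_zero, add_smul, ← add_assoc] using h

theorem SmoothAlongCurves.contDiff_line (hf : SmoothAlongCurves Set.univ f) (x v : E) :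
    ContDiff ℝ ∞ (fun t : ℝ => f (x + t • v)) :=
  hf (fun t : ℝ => x + t • v) (contDiff_const.add (contDiff_id.smul contDiff_const))
    fun _ => Set.mem_univ _

theorem SmoothAlongCurves.hasLineDerivAt (hf : SmoothAlongCurves Set.univ f) (v : E) (p : ℕ)
    (x : E) : HasLineDerivAt ℝ (iteratedLineDeriv f v p) (iteratedLineDeriv f v (p + 1) x) x v := by
  have h := ((hf.contDiff_line x v).differentiable_iteratedDeriv p
    (mod_cast WithTop.coe_lt_top _) 0).hasDerivAt
  rw [← iteratedDeriv_succ] at h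
  simpa only [HasLineDerivAt, iteratedLineDeriv_add_smul] using! h

theorem iteratedDeriv_comp_curveThrough (hf : SmoothAlongCurves Set.univ f) (x : E) (a : ℕ → E)
    (l : ℕ → ℝ) (v : E) (p k : ℕ) :
    iteratedDeriv p (fun t => f (x + curveThrough a (fun k => l k • v) t)) (bumpCentre k) =
      l k ^ p • iteratedLineDeriv f v p (x + a k) := by
  have hshift := congrFun (iteratedDeriv_comp_const_add p
    (fun t => f (x + curveThrough a (fun k => l k • v) t)) (bumpCentre k)) 0
  have hline : (fun s => f (x + curveThrough a (fun k => l k • v) (bumpCentre k + s))) =ᶠ[𝓝 0]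
      fun s => f (x + a k + (l k * s) • v) := by
    filter_upwards [eventually_curveThrough_bumpCentre_add a (fun k => l k • v) k] with s hs
    rw [hs, smul_smul, mul_comm s, add_assoc]
  rw [add_zero] at hshift
  rw [← hshift, hline.iteratedDeriv_eq, iteratedDeriv_comp_const_smul
    (f := fun s : ℝ => f (x + a k + s • v)) ((hf.contDiff_line _ v).of_le (mod_cast le_top))]
  simp [iteratedLineDeriv]

theorem SmoothAlongCurves.exists_norm_iteratedLineDeriv_le [CompleteSpace E]
    (hf : SmoothAlongCurves Set.univ f) (v : E) (p : ℕ) (x : E) :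
    ∃ r > 0, ∃ C, ∀ y ∈ ball x r, ‖iteratedLineDeriv f v p y‖ ≤ C := by
  by_contra! hcon
  -- Otherwise a smooth curve passes through points `y k → x` with velocities `l k • v`, and the
  -- `p`-th derivatives of `f` along it, `l k ^ p` times those along `v`, are unbounded.
  let l : ℕ → ℝ := fun k => curveRadius k / (‖v‖ + 1)
  have hl (k : ℕ) : 0 < l k := div_pos (curveRadius_pos k) (by positivity)
  have hlv (k : ℕ) : ‖l k • v‖ ≤ curveRadius k := by
    rw [norm_smul, Real.norm_of_nonneg (hl k).le, div_mul_eq_mul_div, div_le_iff₀ (by positivity)]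
    exact mul_le_mul_of_nonneg_left (le_add_of_nonneg_right zero_le_one) (curveRadius_pos k).le
  choose y hyx hyk using fun k => hcon (curveRadius k) (curveRadius_pos k) (k / l k ^ p)
  let c : ℝ → E := fun t => x + curveThrough (fun k => y k - x) (fun k => l k • v) t
  have hc : ContDiff ℝ ∞ c := contDiff_const.add <| contDiff_curveThrough
    (fun k => (dist_eq_norm (y k) x ▸ mem_ball.1 (hyx k)).le) hlv
  have hfc : Continuous (iteratedDeriv p (f ∘ c)) :=
    (hf c hc fun _ => Set.mem_univ _).continuous_iteratedDeriv p (mod_cast le_top)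
  obtain ⟨B, hB⟩ := ((hfc.tendsto 0).comp tendsto_bumpCentre).norm.bddAbove_range
  obtain ⟨k, hk⟩ := exists_nat_gt B
  have hBk : l k ^ p * ‖iteratedLineDeriv f v p (y k)‖ ≤ B := by
    have h : iteratedDeriv p (f ∘ c) (bumpCentre k) = l k ^ p • iteratedLineDeriv f v p (y k) := by
      simpa using! iteratedDeriv_comp_curveThrough hf x (fun k => y k - x) l v p k
    simpa [h, norm_smul, abs_of_pos (hl k)] using hB (Set.mem_range_self k)
  have hky : k < l k ^ p * ‖iteratedLineDeriv f v p (y k)‖ :=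
    (div_lt_iff₀' (pow_pos (hl k) p)).1 (hyk k)
  linarith

end SmoothAlongCurves

/-! ### Boman's theorem -/

section Boman

open Filter Topology Metric MeasureTheory FourierTransform
open scoped RealInnerProductSpace

theorem iteratedLineDeriv_eq_zero_of_notMem_tsupport {E F : Type*} [NormedAddCommGroup E]
    [NormedSpace ℝ E] [NormedAddCommGroup F] [NormedSpace ℝ F] {f : E → F} {x : E}
    (hx : x ∉ tsupport f) (v : E) (p : ℕ) : iteratedLineDeriv f v p x = 0 := by
  have hline : Tendsto (fun t : ℝ => x + t • v) (𝓝 0) (𝓝 x) := by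
    have : Continuous (fun t : ℝ => x + t • v) := by fun_prop
    simpa using this.tendsto 0
  have hzero : (fun t : ℝ => f (x + t • v)) =ᶠ[𝓝 0] fun _ => 0 :=
    hline.eventually (notMem_tsupport_iff_eventuallyEq.1 hx)
  simp [iteratedLineDeriv, hzero.iteratedDeriv_eq]

theorem SmoothAlongCurves.exists_forall_norm_iteratedLineDeriv_le {E F : Type*}
    [NormedAddCommGroup E] [NormedSpace ℝ E] [CompleteSpace E] [NormedAddCommGroup F]
    [NormedSpace ℝ F] {f : E → F} (hf : SmoothAlongCurves Set.univ f) (hc : HasCompactSupport f)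
    (v : E) (p : ℕ) : ∃ C, ∀ x, ‖iteratedLineDeriv f v p x‖ ≤ C := by
  choose r hr C hC using hf.exists_norm_iteratedLineDeriv_le v p
  obtain ⟨t, -, ht⟩ := hc.isCompact.elim_nhds_subcover (fun x => ball x (r x))
    fun x _ => ball_mem_nhds x (hr x)
  refine ⟨∑ x ∈ t, |C x|, fun y => ?_⟩
  by_cases hy : y ∈ tsupport f
  · obtain ⟨x, hx, hyx⟩ := Set.mem_iUnion₂.1 (ht hy)
    exact (hC x y hyx).trans <| (le_abs_self _).trans <|
      Finset.single_le_sum (f := fun x => |C x|) (fun _ _ => abs_nonneg _) hx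
  · rw [iteratedLineDeriv_eq_zero_of_notMem_tsupport hy, norm_zero]
    positivity

theorem norm_le_sum_abs_inner {V ι : Type*} [NormedAddCommGroup V] [InnerProductSpace ℝ V]
    [Fintype ι] (b : OrthonormalBasis ι ℝ V) (w : V) : ‖w‖ ≤ ∑ i, |⟪b i, w⟫| :=
  calc ‖w‖ = ‖∑ i, ⟪b i, w⟫ • b i‖ := by rw [b.sum_repr']
    _ ≤ ∑ i, ‖⟪b i, w⟫ • b i‖ := norm_sum_le _ _
    _ = ∑ i, |⟪b i, w⟫| := by simp [norm_smul]

theorem hasLineDerivAt_fourierChar_neg_inner {V : Type*} [NormedAddCommGroup V]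
    [InnerProductSpace ℝ V] (w x v : V) :
    HasLineDerivAt ℝ (fun x : V => (Real.fourierChar (-⟪x, w⟫) : ℂ))
      (-(2 * Real.pi * Complex.I * ⟪v, w⟫) * Real.fourierChar (-⟪x, w⟫)) x v := by
  have h : HasLineDerivAt ℝ (fun x : V => (Real.fourierChar (-⟪x, w⟫) : ℂ))
      ((-2 * Real.pi * Complex.I * Real.fourierChar (-⟪x, w⟫)) * ⟪v, w⟫) x v :=
    (Real.hasFDerivAt_fourierChar_neg_bilinear_left (innerSL ℝ) x w).hasLineDerivAt v
  convert! h using 1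
  ring

section Fourier

variable {V : Type*} [NormedAddCommGroup V] [InnerProductSpace ℝ V] [FiniteDimensional ℝ V]
  [MeasurableSpace V] [BorelSpace V] {F : Type*} [NormedAddCommGroup F] [NormedSpace ℂ F]
  {f : V → F}

theorem SmoothAlongCurves.stronglyMeasurable_iteratedLineDeriv
    (hf : SmoothAlongCurves Set.univ f) (v : V) (p : ℕ) :
    StronglyMeasurable (iteratedLineDeriv f v p) := by
  induction p with
  | zero =>
    rw [iteratedLineDeriv_zero]
    exact (continuousOn_univ.1 (hf.continuousOn convex_univ)).stronglyMeasurable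
  | succ p ih =>
    have hstep : Tendsto (fun k : ℕ => 1 / ((k : ℝ) + 1)) atTop (𝓝[≠] 0) :=
      tendsto_nhdsWithin_iff.2 ⟨tendsto_one_div_add_atTop_nhds_zero_nat,
        Eventually.of_forall fun k => (Nat.one_div_pos_of_nat (α := ℝ)).ne'⟩
    refine stronglyMeasurable_of_tendsto atTop (fun k : ℕ => ?_)
      (tendsto_pi_nhds.2 fun x => ((hf.hasLineDerivAt v p x).tendsto_slope_zero).comp hstep)
    exact ((ih.comp_measurable (measurable_id.add_const _)).sub ih).const_smul _

theorem SmoothAlongCurves.integrable_iteratedLineDeriv (hf : SmoothAlongCurves Set.univ f)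
    (hc : HasCompactSupport f) (v : V) (p : ℕ) : Integrable (iteratedLineDeriv f v p) := by
  obtain ⟨C, hC⟩ := hf.exists_forall_norm_iteratedLineDeriv_le hc v p
  have hsupp : Function.support (iteratedLineDeriv f v p) ⊆ tsupport f :=
    Function.support_subset_iff'.2 fun x hx =>
      iteratedLineDeriv_eq_zero_of_notMem_tsupport hx v p
  rw [← integrableOn_iff_integrable_of_support_subset hsupp]
  exact Measure.integrableOn_of_bounded hc.measure_lt_top.ne
    (hf.stronglyMeasurable_iteratedLineDeriv v p).aestronglyMeasurable (ae_of_all _ hC)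

theorem SmoothAlongCurves.fourier_iteratedLineDeriv_succ (hf : SmoothAlongCurves Set.univ f)
    (hc : HasCompactSupport f) (v : V) (p : ℕ) (w : V) :
    𝓕 (iteratedLineDeriv f v (p + 1)) w =
      (2 * Real.pi * Complex.I * ⟪v, w⟫) • 𝓕 (iteratedLineDeriv f v p) w := by
  have hint {g : V → F} (hg : Integrable g) :
      Integrable fun x => (Real.fourierChar (-⟪x, w⟫) : ℂ) • g x :=
    (Real.fourierIntegral_convergent_iff w).2 hg
  have hparts := integral_bilinear_hasLineDerivAt_right_eq_neg_left_of_integrable (μ := volume)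
    (B := ContinuousLinearMap.lsmul ℝ ℂ)
    (by
      simp only [ContinuousLinearMap.lsmul_apply, mul_smul]
      exact (hint (hf.integrable_iteratedLineDeriv hc v p)).smul
        (-(2 * Real.pi * Complex.I * ⟪v, w⟫) : ℂ))
    (hint (hf.integrable_iteratedLineDeriv hc v (p + 1)))
    (hint (hf.integrable_iteratedLineDeriv hc v p))
    (fun x _ => hasLineDerivAt_fourierChar_neg_inner w x v) (fun x _ => hf.hasLineDerivAt v p x)
  simp only [ContinuousLinearMap.lsmul_apply, mul_smul, neg_smul, integral_neg, neg_neg,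
    integral_smul] at hparts
  simpa only [Real.fourier_eq, Circle.smul_def, mul_smul] using hparts

theorem SmoothAlongCurves.fourier_iteratedLineDeriv (hf : SmoothAlongCurves Set.univ f)
    (hc : HasCompactSupport f) (v : V) (p : ℕ) (w : V) :
    𝓕 (iteratedLineDeriv f v p) w = (2 * Real.pi * Complex.I * ⟪v, w⟫) ^ p • 𝓕 f w := by
  induction p with
  | zero => simp [iteratedLineDeriv_zero]
  | succ p ih => rw [hf.fourier_iteratedLineDeriv_succ hc, ih, smul_smul, pow_succ']

theorem SmoothAlongCurves.abs_inner_pow_mul_norm_fourier_le (hf : SmoothAlongCurves Set.univ f)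
    (hc : HasCompactSupport f) (v : V) (p : ℕ) (w : V) :
    |⟪v, w⟫| ^ p * ‖𝓕 f w‖ ≤ ∫ x, ‖iteratedLineDeriv f v p x‖ := by
  refine le_trans ?_ (VectorFourier.norm_fourierIntegral_le_integral_norm Real.fourierChar volume
    (innerₗ V) (iteratedLineDeriv f v p) w)
  change _ ≤ ‖𝓕 (iteratedLineDeriv f v p) w‖
  rw [hf.fourier_iteratedLineDeriv hc, norm_smul, norm_pow]
  gcongr
  simp only [norm_mul, Complex.norm_I, mul_one, Complex.norm_real, Real.norm_eq_abs,
    Complex.norm_ofNat, abs_of_pos Real.pi_pos]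
  exact le_mul_of_one_le_left (abs_nonneg _) (by linarith [Real.pi_gt_three])

theorem SmoothAlongCurves.exists_norm_pow_mul_norm_fourier_le (hf : SmoothAlongCurves Set.univ f)
    (hc : HasCompactSupport f) (p : ℕ) : ∃ C, ∀ w, ‖w‖ ^ p * ‖𝓕 f w‖ ≤ C := by
  cases p with
  | zero => exact ⟨_, fun w => by simpa using hf.abs_inner_pow_mul_norm_fourier_le hc 0 0 w⟩
  | succ p =>
    let b := stdOrthonormalBasis ℝ V
    let n := Module.finrank ℝ V
    refine ⟨(n : ℝ) ^ p * ∑ i, ∫ x, ‖iteratedLineDeriv f (b i) (p + 1) x‖, fun w => ?_⟩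
    calc ‖w‖ ^ (p + 1) * ‖𝓕 f w‖
        ≤ (∑ i, |⟪b i, w⟫|) ^ (p + 1) * ‖𝓕 f w‖ := by
          gcongr
          exact norm_le_sum_abs_inner b w
      _ ≤ ((n : ℝ) ^ p * ∑ i, |⟪b i, w⟫| ^ (p + 1)) * ‖𝓕 f w‖ := by
          gcongr
          simpa [n] using pow_sum_le_card_mul_sum_pow (s := Finset.univ)
            (fun i _ => abs_nonneg ⟪b i, w⟫) p
      _ = (n : ℝ) ^ p * ∑ i, |⟪b i, w⟫| ^ (p + 1) * ‖𝓕 f w‖ := by rw [mul_assoc, Finset.sum_mul]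
      _ ≤ (n : ℝ) ^ p * ∑ i, ∫ x, ‖iteratedLineDeriv f (b i) (p + 1) x‖ := by
          gcongr with i
          exact hf.abs_inner_pow_mul_norm_fourier_le hc (b i) (p + 1) w

theorem SmoothAlongCurves.contDiff_of_hasCompactSupport [CompleteSpace F]
    (hf : SmoothAlongCurves Set.univ f) (hc : HasCompactSupport f) : ContDiff ℝ ∞ f := by
  have hcont : Continuous f := continuousOn_univ.1 (hf.continuousOn convex_univ)
  have hint : Integrable f := hcont.integrable_of_hasCompactSupport hc
  have hFcont : Continuous (𝓕 f) := VectorFourier.fourierIntegral_continuous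
    Real.continuous_fourierChar continuous_inner hint
  have hmoment (k : ℕ) : Integrable fun w => ‖w‖ ^ k * ‖𝓕 f w‖ := by
    obtain ⟨C, hC⟩ := hf.exists_norm_pow_mul_norm_fourier_le hc 0
    obtain ⟨D, hD⟩ := hf.exists_norm_pow_mul_norm_fourier_le hc
      (k + (volume : Measure V).integrablePower)
    exact integrable_of_le_of_pow_mul_le (fun w => by simpa using hC w) hD
      hFcont.aestronglyMeasurable
  have hFint : Integrable (𝓕 f) :=
    (integrable_norm_iff hFcont.aestronglyMeasurable).1 (by simpa using hmoment 0)
  have hinv : f = fun x => 𝓕 (𝓕 f) (-x) := by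
    rw [← hcont.fourierInv_fourier_eq hint hFint]
    funext x
    rw [Real.fourierInv_eq_fourier_neg, hcont.fourierInv_fourier_eq hint hFint]
  rw [hinv]
  exact (Real.contDiff_fourier fun k _ => hmoment k).comp contDiff_neg

end Fourier

theorem SmoothAlongCurves.contDiff_real_of_inner {V : Type*} [NormedAddCommGroup V]
    [InnerProductSpace ℝ V] [FiniteDimensional ℝ V] {f : V → ℝ}
    (hf : SmoothAlongCurves Set.univ f) : ContDiff ℝ ∞ f := by
  borelize V
  rw [contDiff_iff_contDiffAt]
  intro x
  let χ : ContDiffBump x := ⟨1, 2, one_pos, one_lt_two⟩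
  let g : V → ℂ := fun y => ((χ y * f y : ℝ) : ℂ)
  have hg : SmoothAlongCurves Set.univ g := fun c hc hcK =>
    Complex.ofRealCLM.contDiff.comp ((χ.contDiff.comp hc).mul (hf c hc hcK))
  have hgc : HasCompactSupport g :=
    (χ.hasCompactSupport.mul_right (f' := f)).comp_left (g := Complex.ofReal) Complex.ofReal_zero
  have hre := Complex.reCLM.contDiff.comp (hg.contDiff_of_hasCompactSupport hgc)
  refine hre.contDiffAt.congr_of_eventuallyEq ?_
  filter_upwards [χ.eventuallyEq_one] with y hy
  simp [g, hy]

/-- **Boman's theorem** -/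
theorem SmoothAlongCurves.contDiff {E F : Type*} [NormedAddCommGroup E] [NormedSpace ℝ E]
    [FiniteDimensional ℝ E] [NormedAddCommGroup F] [NormedSpace ℝ F] [FiniteDimensional ℝ F]
    {f : E → F} (hf : SmoothAlongCurves Set.univ f) : ContDiff ℝ ∞ f := by
  let e := toEuclidean (E := E)
  let e' := toEuclidean (E := F)
  have he : SmoothAlongCurves Set.univ (e' ∘ f ∘ e.symm) := fun c hc _ =>
    e'.contDiff.comp (hf _ (e.symm.contDiff.comp hc) fun _ => Set.mem_univ _)
  have h : ContDiff ℝ ∞ (e' ∘ f ∘ e.symm) := contDiff_euclidean.2 fun i =>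
    SmoothAlongCurves.contDiff_real_of_inner fun c hc hcK => contDiff_euclidean.1 (he c hc hcK) i
  rwa [e'.comp_contDiff_iff, e.symm.contDiff_comp_iff] at h

end Boman

/-! ### Kriegl's theorem -/

section Kriegl

open Filter Topology Metric

/-- The reparametrization `t ↦ t² / (1 + t²)`, with values in `[0, 1)`: running through a segment
in this way one starts at its end point with velocity zero, so that the curve can be continued to
negative times inside the segment. -/
noncomputable def squash (t : ℝ) : ℝ := t ^ 2 / (1 + t ^ 2)

theorem contDiff_squash : ContDiff ℝ ∞ squash :=
  (contDiff_id.pow 2).div (contDiff_const.add (contDiff_id.pow 2)) fun t => by positivity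

theorem squash_mem_Icc (t : ℝ) : squash t ∈ Set.Icc (0 : ℝ) 1 := by
  refine ⟨by unfold squash; positivity, ?_⟩
  rw [squash, div_le_one (by positivity)]
  linarith

theorem squash_zero : squash 0 = 0 := by simp [squash]

theorem hasDerivAt_squash (t : ℝ) : HasDerivAt squash (2 * t / (1 + t ^ 2) ^ 2) t := by
  have h : (1 + t ^ 2 : ℝ) ≠ 0 := by positivity
  refine ((hasDerivAt_pow 2 t).div ((hasDerivAt_pow 2 t).const_add 1) h).congr_deriv ?_
  field_simp
  ring

theorem hasDerivAt_deriv_squash : HasDerivAt (fun t : ℝ => 2 * t / (1 + t ^ 2) ^ 2) 2 0 := by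
  refine (((hasDerivAt_id (0 : ℝ)).const_mul 2).div
    (((hasDerivAt_pow 2 (0 : ℝ)).const_add 1).pow 2) (by norm_num)).congr_deriv ?_
  norm_num

theorem contDiff_deriv_right {F : Type*} [NormedAddCommGroup F] [NormedSpace ℝ F]
    {f : ℝ × ℝ → F} (hf : ContDiff ℝ ∞ f) :
    ContDiff ℝ ∞ fun q : ℝ × ℝ => deriv (fun t => f (q.1, t)) q.2 :=
  ContDiff.fderiv_apply (f := fun (q : ℝ × ℝ) t => f (q.1, t)) (m := ∞)
    (hf.comp ((contDiff_fst.comp contDiff_fst).prodMk contDiff_snd)) contDiff_snd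
    (contDiff_const (c := 1)) (by simp)

theorem contDiff_iteratedDeriv_two_right {F : Type*} [NormedAddCommGroup F] [NormedSpace ℝ F]
    {f : ℝ × ℝ → F} (hf : ContDiff ℝ ∞ f) :
    ContDiff ℝ ∞ fun s => iteratedDeriv 2 (fun t => f (s, t)) 0 := by
  simp only [iteratedDeriv_succ, iteratedDeriv_zero]
  exact (contDiff_deriv_right (contDiff_deriv_right hf)).comp (contDiff_id.prodMk contDiff_const)

variable {E F : Type*} [NormedAddCommGroup E] [NormedSpace ℝ E] [NormedAddCommGroup F]
  [NormedSpace ℝ F] {K : Set E} {f : E → F}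

theorem SmoothAlongCurves.contDiff_comp [FiniteDimensional ℝ F] (hf : SmoothAlongCurves K f)
    {G : Type*} [NormedAddCommGroup G] [NormedSpace ℝ G] [FiniteDimensional ℝ G] {φ : G → E}
    (hφ : ContDiff ℝ ∞ φ) (hφK : ∀ u, φ u ∈ K) : ContDiff ℝ ∞ (f ∘ φ) :=
  SmoothAlongCurves.contDiff fun c hc _ => hf (φ ∘ c) (hφ.comp hc) fun _ => hφK _

theorem SmoothAlongCurves.contDiffAt_of_mem_nhds [FiniteDimensional ℝ E] [FiniteDimensional ℝ F]
    (hf : SmoothAlongCurves K f) {x : E} (hx : K ∈ 𝓝 x) : ContDiffAt ℝ ∞ f x := by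
  obtain ⟨r, hr, hrK⟩ := Metric.mem_nhds_iff.1 hx
  let χ : ContDiffBump x := ⟨r / 2, r, by linarith, by linarith⟩
  let φ : E → E := fun u => x + χ u • (u - x)
  have hφ : ContDiff ℝ ∞ φ :=
    contDiff_const.add (χ.contDiff.smul (contDiff_id.sub contDiff_const))
  have hφK (u : E) : φ u ∈ K := by
    refine hrK ?_
    by_cases hu : dist u x < r
    · rw [mem_ball_iff_norm, add_sub_cancel_left, norm_smul, Real.norm_of_nonneg χ.nonneg]
      exact (mul_le_of_le_one_left (norm_nonneg _) χ.le_one).trans_lt (by rwa [← dist_eq_norm])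
    · simpa [φ, χ.zero_of_le_dist (not_lt.1 hu)] using hr
  refine (hf.contDiff_comp hφ hφK).contDiffAt.congr_of_eventuallyEq ?_
  filter_upwards [χ.eventuallyEq_one] with u hu
  simp [φ, hu]

/-- A substitute for the derivative of `f` at `x` in the direction `a - x` which makes sense for
functions on a convex set: half the second derivative of `f` along a curve which starts at `x`
with velocity zero and acceleration `2 • (a - x)`. -/
noncomputable def derivTowards (f : E → F) (a x : E) : F :=
  (1 / 2 : ℝ) • iteratedDeriv 2 (fun t => f (x + squash t • (a - x))) 0

theorem SmoothAlongCurves.smoothAlongCurves_derivTowards [FiniteDimensional ℝ F]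
    (hf : SmoothAlongCurves K f) (hK : Convex ℝ K) {a : E} (ha : a ∈ K) :
    SmoothAlongCurves K (derivTowards f a) := by
  intro c hc hcK
  have hγ : ContDiff ℝ ∞ fun q : ℝ × ℝ => c q.1 + squash q.2 • (a - c q.1) :=
    (hc.comp contDiff_fst).add ((contDiff_squash.comp contDiff_snd).smul
      (contDiff_const.sub (hc.comp contDiff_fst)))
  have hfγ := hf.contDiff_comp hγ fun q => hK.add_smul_sub_mem (hcK q.1) ha (squash_mem_Icc q.2)
  exact (contDiff_iteratedDeriv_two_right hfγ).const_smul (1 / 2 : ℝ)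

theorem derivTowards_eq_fderiv {x : E} (hf : ContDiffAt ℝ ∞ f x) (a : E) :
    derivTowards f a x = fderiv ℝ f x (a - x) := by
  let γ : ℝ → E := fun t => x + squash t • (a - x)
  have hγ : ContDiff ℝ ∞ γ := contDiff_const.add (contDiff_squash.smul contDiff_const)
  have hγ0 : γ 0 = x := by simp [γ, squash_zero]
  have hfirst : ∀ᶠ t in 𝓝 (0 : ℝ), deriv (fun t => f (γ t)) t =
      (2 * t / (1 + t ^ 2) ^ 2) • fderiv ℝ f (γ t) (a - x) := by
    have hnear : ∀ᶠ y in 𝓝 (γ 0), ContDiffAt ℝ 1 f y := by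
      rw [hγ0]
      exact (hf.of_le (by simp)).eventually (by simp)
    filter_upwards [hγ.continuous.continuousAt.eventually hnear] with t ht
    have hγt : HasDerivAt γ ((2 * t / (1 + t ^ 2) ^ 2) • (a - x)) t :=
      ((hasDerivAt_squash t).smul_const (a - x)).const_add x
    rw [← map_smul]
    exact ((ht.differentiableAt (by simp)).hasFDerivAt.comp_hasDerivAt t hγt).deriv
  have hfactor : DifferentiableAt ℝ (fun t => fderiv ℝ f (γ t) (a - x)) 0 := by
    have hfderiv : ContDiffAt ℝ ∞ (fderiv ℝ f) (γ 0) := by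
      rw [hγ0]
      exact hf.fderiv_right (by simp)
    exact ((hfderiv.comp (0 : ℝ) hγ.contDiffAt).differentiableAt (by simp)).clm_apply
      (differentiableAt_const _)
  have hsecond := (hasDerivAt_deriv_squash.smul hfactor.hasDerivAt).congr_of_eventuallyEq hfirst
  rw [derivTowards, iteratedDeriv_succ, iteratedDeriv_one, hsecond.deriv]
  simp [hγ0]

theorem tendsto_add_smul_sub (z a : E) :
    Tendsto (fun θ : ℝ => z + θ • (a - z)) (𝓝[>] 0) (𝓝 z) := by
  have h : Continuous fun θ : ℝ => z + θ • (a - z) := by fun_prop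
  simpa using (h.tendsto 0).mono_left nhdsWithin_le_nhds

theorem norm_image_sub_sub_le_of_interior {L : E →L[ℝ] F} {f' : E → E →L[ℝ] F} {ε : ℝ}
    (hK : Convex ℝ K) {a : E} (ha : a ∈ interior K) (hf : ContinuousOn f K) {s : Set E}
    (hs : IsOpen s) (hsc : Convex ℝ s) (h : ∀ z ∈ interior K, HasFDerivAt f (f' z) z)
    (hε : ∀ z ∈ K ∩ s, ‖f' z - L‖ ≤ ε) {x y : E} (hx : x ∈ K ∩ s) (hy : y ∈ K ∩ s) :
    ‖f y - f x - L (y - x)‖ ≤ ε * ‖y - x‖ := by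
  have hmem {z : E} (hz : z ∈ K ∩ s) :
      ∀ᶠ θ : ℝ in 𝓝[>] 0, z + θ • (a - z) ∈ interior K ∩ s := by
    filter_upwards [(tendsto_add_smul_sub z a).eventually (hs.mem_nhds hz.2),
      Ioc_mem_nhdsGT one_pos] with θ hθs hθ
    exact ⟨hK.add_smul_sub_mem_interior hz.1 ha hθ, hθs⟩
  have hflim {z : E} (hz : z ∈ K ∩ s) :
      Tendsto (fun θ : ℝ => f (z + θ • (a - z))) (𝓝[>] 0) (𝓝 (f z)) :=
    (hf z hz.1).tendsto.comp (tendsto_nhdsWithin_iff.2 ⟨tendsto_add_smul_sub z a,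
      (hmem hz).mono fun _ h => interior_subset h.1⟩)
  have hdiff := (tendsto_add_smul_sub y a).sub (tendsto_add_smul_sub x a)
  refine le_of_tendsto_of_tendsto
    (((hflim hy).sub (hflim hx)).sub ((L.continuous.tendsto _).comp hdiff)).norm
    (hdiff.norm.const_mul ε) ?_
  filter_upwards [hmem hx, hmem hy] with θ hxθ hyθ
  exact (hK.interior.inter hsc).norm_image_sub_le_of_norm_hasFDerivWithin_le'
    (fun z hz => (h z hz.1).hasFDerivWithinAt)
    (fun z hz => hε z ⟨interior_subset hz.1, hz.2⟩) hxθ hyθ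

theorem hasFDerivWithinAt_of_interior {f' : E → E →L[ℝ] F} (hK : Convex ℝ K)
    (hKi : (interior K).Nonempty) (hf : ContinuousOn f K) (hf' : ContinuousOn f' K)
    (h : ∀ x ∈ interior K, HasFDerivAt f (f' x) x) {x : E} (hx : x ∈ K) :
    HasFDerivWithinAt f (f' x) K x := by
  obtain ⟨a, ha⟩ := hKi
  refine hasFDerivWithinAt_iff_isLittleO.2 (Asymptotics.isLittleO_iff.2 fun ε hε => ?_)
  obtain ⟨δ, hδ, hfδ⟩ := Metric.continuousWithinAt_iff.1 (hf' x hx) ε hε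
  filter_upwards [self_mem_nhdsWithin, mem_nhdsWithin_of_mem_nhds (ball_mem_nhds x hδ)]
    with y hy hyδ
  exact norm_image_sub_sub_le_of_interior hK ha hf isOpen_ball (convex_ball x δ) h
    (fun z hz => by rw [← dist_eq_norm]; exact (hfδ hz.1 hz.2).le)
    ⟨hx, mem_ball_self hδ⟩ ⟨hy, hyδ⟩

theorem exists_ne_zero_forall_add_smul_mem {ι : Type*} [Finite ι] {a : E} (ha : K ∈ 𝓝 a)
    (v : ι → E) : ∃ ε : ℝ, ε ≠ 0 ∧ ∀ j, a + ε • v j ∈ K := by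
  have hnear : ∀ᶠ ε : ℝ in 𝓝 0, ∀ j, a + ε • v j ∈ K := eventually_all.2 fun j => by
    have hcont : Continuous fun ε : ℝ => a + ε • v j := by fun_prop
    exact hcont.continuousAt.eventually (by simpa using ha)
  obtain ⟨ε, hε, hε0⟩ := ((hnear.filter_mono nhdsWithin_le_nhds).and
    (self_mem_nhdsWithin (s := {(0 : ℝ)}ᶜ))).exists
  exact ⟨ε, hε0, hε⟩

theorem sum_coord_smulRight_derivTowards {ι : Type*} [Fintype ι] [FiniteDimensional ℝ E]
    (b : Module.Basis ι ℝ E) {ε : ℝ} (hε : ε ≠ 0) {x : E} (hf : ContDiffAt ℝ ∞ f x) (a : E) :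
    ∑ j, (b.coord j).toContinuousLinearMap.smulRight
      (ε⁻¹ • (derivTowards f (a + ε • b j) x - derivTowards f a x)) = fderiv ℝ f x := by
  ext v
  have hdiff (j : ι) :
      ε⁻¹ • (derivTowards f (a + ε • b j) x - derivTowards f a x) = fderiv ℝ f x (b j) := by
    rw [derivTowards_eq_fderiv hf, derivTowards_eq_fderiv hf, ← map_sub, ← map_smul,
      sub_sub_sub_cancel_right, add_sub_cancel_left, inv_smul_smul₀ hε]
  conv_rhs => rw [← b.sum_repr v, map_sum]
  simp [hdiff]

theorem SmoothAlongCurves.contDiffOn_nat [FiniteDimensional ℝ E] [FiniteDimensional ℝ F]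
    (hK : Convex ℝ K) (hKi : (interior K).Nonempty) (hf : SmoothAlongCurves K f) (m : ℕ) :
    ContDiffOn ℝ m f K := by
  obtain ⟨a, ha⟩ := hKi
  induction m generalizing f with
  | zero => exact contDiffOn_zero.2 (hf.continuousOn hK)
  | succ m ih =>
    let b := Module.finBasis ℝ E
    obtain ⟨ε, hε, hεK⟩ := exists_ne_zero_forall_add_smul_mem (mem_interior_iff_mem_nhds.1 ha) b
    let f' : E → E →L[ℝ] F := fun x => ∑ j, (b.coord j).toContinuousLinearMap.smulRight
      (ε⁻¹ • (derivTowards f (a + ε • b j) x - derivTowards f a x))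
    have hf' : ContDiffOn ℝ m f' K := ContDiffOn.sum fun j _ => contDiffOn_const.smulRight
      (contDiffOn_const.smul ((ih (hf.smoothAlongCurves_derivTowards hK (hεK j))).sub
        (ih (hf.smoothAlongCurves_derivTowards hK (interior_subset ha)))))
    have hinterior (x : E) (hx : x ∈ interior K) : HasFDerivAt f (f' x) x := by
      have hfx := hf.contDiffAt_of_mem_nhds (mem_interior_iff_mem_nhds.1 hx)
      simp only [f', sum_coord_smulRight_derivTowards b hε hfx a]
      exact (hfx.differentiableAt (by simp)).hasFDerivAt
    exact_mod_cast (contDiffOn_succ_iff_hasFDerivWithinAt_of_uniqueDiffOn (n := m)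
      (uniqueDiffOn_convex hK ⟨a, ha⟩)).2 ⟨fun h => by simp at h, f', hf', fun x hx =>
        hasFDerivWithinAt_of_interior hK ⟨a, ha⟩ (hf.continuousOn hK) hf'.continuousOn
          hinterior hx⟩

theorem nonempty_interior_preimage_direction [FiniteDimensional ℝ E] (hK : Convex ℝ K) {p : E}
    (hp : p ∈ K) :
    (interior ((fun v : (affineSpan ℝ K).direction => p + (v : E)) ⁻¹' K)).Nonempty := by
  obtain ⟨-, q, hq, -⟩ := Set.Nonempty.intrinsicInterior hK ⟨p, hp⟩
  have hpA := subset_affineSpan ℝ K hp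
  let g (v : (affineSpan ℝ K).direction) : affineSpan ℝ K :=
    ⟨p + v, by rw [add_comm]; exact AffineSubspace.vadd_mem_of_mem_direction v.2 hpA⟩
  have hg : Continuous g := Continuous.subtype_mk (by fun_prop) _
  have hqp : (q : E) - p ∈ (affineSpan ℝ K).direction :=
    AffineSubspace.vsub_mem_direction q.2 hpA
  have hgq : g ⟨q - p, hqp⟩ = q := Subtype.ext (add_sub_cancel p (q : E))
  exact ⟨⟨q - p, hqp⟩, mem_interior.2 ⟨g ⁻¹' interior ((↑) ⁻¹' K),
    fun v hv => interior_subset (s := ((↑) : affineSpan ℝ K → E) ⁻¹' K) hv,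
    isOpen_interior.preimage hg, by rwa [Set.mem_preimage, hgq]⟩⟩

/-- **Kriegl's theorem** -/
theorem SmoothAlongCurves.contDiffOn [FiniteDimensional ℝ E] [FiniteDimensional ℝ F]
    (hf : SmoothAlongCurves K f) (hK : Convex ℝ K) : ContDiffOn ℝ ∞ f K := by
  rcases K.eq_empty_or_nonempty with rfl | ⟨p, hp⟩
  · exact fun x hx => hx.elim
  let V := (affineSpan ℝ K).direction
  obtain ⟨π, hπ⟩ := Submodule.ClosedComplemented.of_finiteDimensional V
  let j : V → E := fun v => p + v
  have hj : ContDiff ℝ ∞ j := contDiff_const.add V.subtypeL.contDiff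
  have hjπ : ∀ y ∈ K, j (π (y - p)) = y := fun y hy => by
    have hyp : y - p ∈ V := AffineSubspace.vsub_mem_direction (subset_affineSpan ℝ K hy)
      (subset_affineSpan ℝ K hp)
    simp only [j, hπ ⟨y - p, hyp⟩, add_sub_cancel]
  have hjK : Convex ℝ (j ⁻¹' K) := (hK.translate_preimage_right p).linear_preimage V.subtype
  have hfj : SmoothAlongCurves (j ⁻¹' K) (f ∘ j) := fun c hc hcK => hf (j ∘ c) (hj.comp hc) hcK
  have hfjK : ContDiffOn ℝ ∞ (f ∘ j) (j ⁻¹' K) := contDiffOn_infty.2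
    (hfj.contDiffOn_nat hjK (nonempty_interior_preimage_direction hK hp))
  have hπK : ContDiffOn ℝ ∞ (fun y => π (y - p)) K :=
    (π.contDiff.comp (contDiff_id.sub contDiff_const)).contDiffOn
  refine (hfjK.comp hπK fun y hy => ?_).congr fun y hy => ?_
  · rwa [Set.mem_preimage, hjπ y hy]
  · simp only [Function.comp_apply, hjπ y hy]

end Kriegl

/-! ### Smooth maps between test spaces -/

section TestSpaces

open Filter Topology Metric

variable {S T : TestSpace}

theorem isSmooth_of_contDiff {f : S → T} (g : Euc S.dim → Euc T.dim) (hg : ContDiff ℝ ∞ g)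
    (h : ∀ x : S, g x = f x) : IsSmooth f :=
  ⟨g, hg.contDiffOn, h⟩

theorem isSmooth_id (S : TestSpace) : IsSmooth (id : S → S) :=
  isSmooth_of_contDiff id contDiff_id fun _ => rfl

theorem isSmooth_const (y : T) : IsSmooth (fun _ : S => y) :=
  isSmooth_of_contDiff _ (contDiff_const (c := (y : Euc T.dim))) fun _ => rfl

theorem isSmooth_of_forall_eq {f : S → T} (h : ∀ x y, f x = f y) : IsSmooth f := by
  rcases isEmpty_or_nonempty S with hS | ⟨⟨x⟩⟩
  · exact isSmooth_of_contDiff (fun _ => 0) contDiff_const fun x => hS.elim x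
  · exact funext (fun y => h x y) ▸ isSmooth_const (f x)

/-- The extension of a map between test spaces to the ambient Euclidean spaces, by zero outside
the source. -/
noncomputable def extendByZero (f : S → T) : Euc S.dim → Euc T.dim :=
  Function.extend Subtype.val (fun x => (f x : Euc T.dim)) 0

theorem extendByZero_coe (f : S → T) (x : S) : extendByZero f x = f x :=
  Subtype.val_injective.extend_apply _ _ x

theorem isSmooth_iff_contDiffOn_extendByZero {f : S → T} :
    IsSmooth f ↔ ContDiffOn ℝ ∞ (extendByZero f) S.carrier := by
  refine ⟨fun ⟨g, hg, h⟩ => hg.congr fun x hx => ?_, fun h => ⟨_, h, extendByZero_coe f⟩⟩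
  exact (extendByZero_coe f ⟨x, hx⟩).trans (h ⟨x, hx⟩).symm

/-- A map to a test space with values in a piece of it, as a map to that piece. -/
def cutMk {α : Type*} {V : Set (Euc T.dim)} (f : α → T) (h : ∀ x, (f x : Euc T.dim) ∈ V) (x : α) :
    T.cut V :=
  ⟨(f x : Euc T.dim), (f x).2, h x⟩

/-- The inclusion of a piece of a test space. -/
def cutIncl (S : TestSpace) (U : Set (Euc S.dim)) (y : S.cut U) : S := ⟨y.1, y.2.1⟩

theorem isSmooth_cutIncl (S : TestSpace) (U : Set (Euc S.dim)) : IsSmooth (cutIncl S U) :=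
  isSmooth_of_contDiff (S := S.cut U) id contDiff_id fun _ => rfl

theorem IsSmooth.cutMk {f : S → T} (hf : IsSmooth f) {V : Set (Euc T.dim)}
    (h : ∀ x, (f x : Euc T.dim) ∈ V) : IsSmooth (cutMk f h) :=
  hf

theorem IsSmooth.exists_isOpen_preimage {f : S → T} (hf : IsSmooth f) {U : Set (Euc T.dim)}
    (hU : IsOpen U) :
    ∃ U' : Set (Euc S.dim), IsOpen U' ∧ ∀ x : S, (x : Euc S.dim) ∈ U' ↔ (f x : Euc T.dim) ∈ U := by
  obtain ⟨U', hU', h⟩ :=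
    isOpen_induced_iff.1 (hU.preimage (continuous_subtype_val.comp hf.continuous))
  exact ⟨U', hU', fun x => Set.ext_iff.1 h x⟩

theorem isSmooth_of_locally {f : S → T}
    (h : ∀ x : S, ∃ U : Set (Euc S.dim), IsOpen U ∧ (x : Euc S.dim) ∈ U ∧
      IsSmooth (f ∘ cutIncl S U)) : IsSmooth f := by
  refine isSmooth_iff_contDiffOn_extendByZero.2 fun x hx => ?_
  obtain ⟨U, hU, hxU, (g : Euc S.dim → Euc T.dim), hg, hgf⟩ := h ⟨x, hx⟩
  have heq : ∀ y ∈ S.carrier ∩ U, extendByZero f y = g y := fun y hy =>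
    (extendByZero_coe f ⟨y, hy.1⟩).trans (hgf ⟨y, hy⟩).symm
  exact ((hg.congr heq) x ⟨hx, hxU⟩).mono_of_mem_nhdsWithin
    (inter_mem self_mem_nhdsWithin (mem_nhdsWithin_of_mem_nhds (hU.mem_nhds hxU)))

theorem isSmooth_coordinate (S : TestSpace) (j : Fin S.dim) : IsSmooth (coordinate S j) :=
  isSmooth_of_contDiff (T := realLine) (fun x => WithLp.toLp 2 fun _ => x j)
    (contDiff_euclidean.2 fun _ => (EuclideanSpace.proj (𝕜 := ℝ) j).contDiff) fun _ => rfl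

theorem isSmooth_of_coordinates {f : S → T} (h : ∀ j, IsSmooth (coordinate T j ∘ f)) :
    IsSmooth f := by
  choose g hg hgf using h
  refine ⟨fun x => WithLp.toLp 2 fun j => g j x (0 : Fin 1), ?_, fun x => PiLp.ext fun j => ?_⟩
  · exact contDiffOn_euclidean.2 fun j => contDiffOn_euclidean.1 (hg j) (0 : Fin 1)
  · exact congrArg (fun y : Euc 1 => y 0) (hgf j x)

/-- Maps on `S` are smooth as soon as they are smooth along all smooth curves. -/
def CurveDetermined (S : TestSpace) : Prop :=
  ∀ ⦃T : TestSpace⦄ ⦃f : S → T⦄,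
    (∀ c : realLine → S, IsSmooth c → IsSmooth (f ∘ c)) → IsSmooth f

theorem smoothAlongCurves_extendByZero {f : S → T}
    (h : ∀ c : realLine → S, IsSmooth c → IsSmooth (f ∘ c)) :
    SmoothAlongCurves S.carrier (extendByZero f) := by
  intro c hc hcS
  let c' : realLine → S := fun t => ⟨c (t.1 (0 : Fin 1)), hcS _⟩
  have hc' : IsSmooth c' := isSmooth_of_contDiff (S := realLine) (fun t => c (t (0 : Fin 1)))
    (hc.comp (EuclideanSpace.proj (𝕜 := ℝ) (0 : Fin 1)).contDiff) fun _ => rfl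
  obtain ⟨(g : Euc 1 → Euc T.dim), hg, hgf⟩ := h c' hc'
  have htoLp : ContDiff ℝ ∞ fun t : ℝ => (WithLp.toLp 2 fun _ => t : Euc 1) :=
    contDiff_euclidean.2 fun _ => contDiff_id
  have heq : extendByZero f ∘ c = g ∘ fun t : ℝ => WithLp.toLp 2 fun _ => t := funext fun t =>
    (extendByZero_coe f ⟨c t, hcS t⟩).trans (hgf ⟨WithLp.toLp 2 fun _ => t, Set.mem_univ _⟩).symm
  exact heq ▸ (contDiffOn_univ.1 hg).comp htoLp

theorem curveDetermined_of_convex (hS : Convex ℝ S.carrier) : CurveDetermined S := fun _ _ h =>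
  isSmooth_iff_contDiffOn_extendByZero.2 ((smoothAlongCurves_extendByZero h).contDiffOn hS)

theorem exists_cut_mem_open_convex (hS : IsOpen S.carrier) (x : S) {U : Set (Euc S.dim)}
    (hU : IsOpen U) (hx : (x : Euc S.dim) ∈ U) : ∃ V ⊆ U, IsOpen V ∧ (x : Euc S.dim) ∈ V ∧
      S.cut V ∈ openTests ∩ convexTests := by
  obtain ⟨r, hr, hball⟩ := Metric.isOpen_iff.1 (hS.inter hU) x ⟨x.2, hx⟩
  refine ⟨ball x r, hball.trans Set.inter_subset_right, isOpen_ball, mem_ball_self hr,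
    hS.inter isOpen_ball, ?_⟩
  change Convex ℝ (S.carrier ∩ ball _ r)
  rw [Set.inter_eq_self_of_subset_right (hball.trans Set.inter_subset_left)]
  exact convex_ball _ _

theorem curveDetermined_of_open (hS : IsOpen S.carrier) : CurveDetermined S := fun T f h =>
  isSmooth_of_locally fun x => by
    obtain ⟨V, -, hV, hxV, -, hconvex⟩ :=
      exists_cut_mem_open_convex hS x isOpen_univ (Set.mem_univ _)
    exact ⟨V, hV, hxV, curveDetermined_of_convex hconvex fun c hc =>
      h _ ((isSmooth_cutIncl S V).comp hc)⟩

theorem curveDetermined_of_mem_euclideanTests (hS : S ∈ euclideanTests) : CurveDetermined S :=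
  curveDetermined_of_open (by rw [show S.carrier = Set.univ from hS]; exact isOpen_univ)

/-- A test category which contains arbitrarily small pieces of its members, so that local
properties of maps on them can be checked inside the test category. -/
def HasSmallCuts (𝒯 : Set TestSpace) : Prop :=
  ∀ S ∈ 𝒯, ∀ (x : S) (U : Set (Euc S.dim)), IsOpen U → (x : Euc S.dim) ∈ U →
    ∃ V ⊆ U, IsOpen V ∧ (x : Euc S.dim) ∈ V ∧ S.cut V ∈ 𝒯

theorem hasSmallCuts_convexTests : HasSmallCuts convexTests := fun _ hS x _ hU hx =>
  let ⟨r, hr, hball⟩ := Metric.isOpen_iff.1 hU x hx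
  ⟨ball x r, hball, isOpen_ball, mem_ball_self hr, Convex.inter hS (convex_ball _ _)⟩

/-- The convex open subsets of Euclidean spaces. -/
abbrev openConvexTests : Set TestSpace := openTests ∩ convexTests

theorem hasSmallCuts_openConvexTests : HasSmallCuts openConvexTests := fun _ hS x _ hU hx =>
  exists_cut_mem_open_convex hS.1 x hU hx

theorem line_subset_openConvex : lineTests ⊆ openConvexTests :=
  Set.subset_inter line_subset_open fun _ hS => (line_subset_closedConvex hS).2

/-- The one-point test space. -/
def pointTest : TestSpace := ⟨0, Set.univ⟩

instance : Subsingleton pointTest := inferInstanceAs (Subsingleton (Set.univ : Set (Euc 0)))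

theorem pointTest_mem_openConvexTests : pointTest ∈ openConvexTests :=
  ⟨isOpen_univ (X := Euc 0), convex_univ (E := Euc 0)⟩

theorem isTerminalTest_pointTest (𝒯 : Set TestSpace) : IsTerminalTest 𝒯 pointTest := fun _ _ =>
  ⟨fun _ => ⟨0, Set.mem_univ _⟩, isSmooth_const _, fun _ _ => funext fun _ => Subsingleton.elim _ _⟩

theorem IsTerminalTest.nonempty {𝒯 : Set TestSpace} (h𝒯 : realLine ∈ 𝒯)
    (hS : IsTerminalTest 𝒯 S) : Nonempty S :=
  let ⟨f, _, _⟩ := hS realLine h𝒯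
  ⟨f ⟨0, Set.mem_univ _⟩⟩

theorem IsTerminalTest.subsingleton {𝒯 : Set TestSpace} (h𝒯 : realLine ∈ 𝒯)
    (hS : IsTerminalTest 𝒯 S) : Subsingleton S :=
  ⟨fun x y => congrFun ((hS realLine h𝒯).unique (isSmooth_const x) (isSmooth_const y))
    ⟨0, Set.mem_univ _⟩⟩

end TestSpaces

/-! ### Functors which only change the test maps -/

section FibreFunctors

variable {B : Underlying.{u}} {𝒮 𝒯 : Set TestSpace}

theorem isMor_id_of_le {X : Type u} {b : B.Str X} {V W : VirtualStr B 𝒯 b} (h : V ≤ W) :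
    IsMor V W id :=
  ⟨B.id_mor b, h⟩

namespace FibreFunctor

variable {P : Condition B 𝒯} {Q : Condition B 𝒮}

theorem faithful (F : FibreFunctor P Q) : F.functor.Faithful where
  map_injective {_ _ f g} h :=
    Space.Hom.ext (congrArg Space.Hom.toFun h : (F.functor.map f).toFun = (F.functor.map g).toFun)

theorem functor_eq_id (F : FibreFunctor P P) (h : ∀ ⦃X : Type u⦄ (b : B.Str X) V, F.obj b V = V) :
    F.functor = 𝟭 (Space P) := by
  obtain ⟨obj, map⟩ := F
  obtain rfl : obj = fun X b V => V := funext fun X => funext fun b => funext fun V => h b V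
  rfl

/-- The composite of two functors which only change the test maps. -/
def comp {ℛ : Set TestSpace} {R : Condition B ℛ} (F : FibreFunctor P Q) (G : FibreFunctor Q R) :
    FibreFunctor P R where
  obj _ b V := G.obj b (F.obj b V)
  map _ _ b c V W f hf := G.map b c _ _ f (F.map b c V W f hf)

/-- The adjunction given by fibrewise comparisons, whose unit and counit have the identity as
underlying map. -/
def adjunction (F : FibreFunctor P Q) (G : FibreFunctor Q P)
    (hunit : ∀ ⦃X : Type u⦄ (b : B.Str X) V, V ≤ G.obj b (F.obj b V))
    (hcounit : ∀ ⦃X : Type u⦄ (b : B.Str X) W, F.obj b (G.obj b W) ≤ W) :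
    F.functor ⊣ G.functor :=
  Adjunction.mkOfUnitCounit
    { unit := { app := fun A => ⟨id, isMor_id_of_le (hunit A.base ⟨A.str, A.prop⟩)⟩ }
      counit := { app := fun A => ⟨id, isMor_id_of_le (hcounit A.base ⟨A.str, A.prop⟩)⟩ } }

/-- The restriction functor to a smaller test category. -/
def restriction (P : Condition B 𝒯) (Q : Condition B 𝒮) (h : 𝒮 ⊆ 𝒯)
    (hPQ : ∀ ⦃X : Type u⦄ (b : B.Str X) (V : VirtualStr B 𝒯 b), P b V → Q b (V.restrict h)) :
    FibreFunctor P Q where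
  obj _ b V := ⟨V.1.restrict h, hPQ b V.1 V.2⟩
  map _ _ _ _ _ _ _ hf := ⟨hf.1, fun S => hf.2.1 ⟨S.1, h S.2⟩, fun S => hf.2.2 ⟨S.1, h S.2⟩⟩

/-- The inclusion functor between full subcategories defined by conditions. -/
def inclusion (P Q : Condition B 𝒯) (hPQ : P ≤ Q) : FibreFunctor P Q where
  obj _ b V := ⟨V.1, hPQ _ b V.1 V.2⟩
  map _ _ _ _ _ _ _ hf := hf

theorem full_of_restrict_obj {h : 𝒯 ⊆ 𝒮} {F : FibreFunctor P Q}
    (hF : ∀ ⦃X : Type u⦄ (b : B.Str X) V, (F.obj b V).1.restrict h = V.1) : F.functor.Full where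
  map_surjective {A A'} g := ⟨⟨g.toFun, by
    have hg : IsMor ((F.obj A.base ⟨A.str, A.prop⟩).1.restrict h)
        ((F.obj A'.base ⟨A'.str, A'.prop⟩).1.restrict h) g.toFun :=
      ⟨g.isMor.1, fun S => g.isMor.2.1 ⟨S.1, h S.2⟩, fun S => g.isMor.2.2 ⟨S.1, h S.2⟩⟩
    rwa [hF, hF] at hg⟩, rfl⟩

theorem full_inclusion (P Q : Condition B 𝒯) (hPQ : P ≤ Q) : (inclusion P Q hPQ).functor.Full :=
  full_of_restrict_obj (h := subset_rfl) fun _ _ _ => rfl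

variable {h : 𝒮 ⊆ 𝒯} {R : FibreFunctor P Q} {E : FibreFunctor Q P}

/-- Restriction is left adjoint to a join extension which does not enlarge restrictions. -/
def IsJoinExtension.adjunction (hE : E.IsJoinExtension h) (hR : R.IsRestriction h)
    (hle : ∀ ⦃X : Type u⦄ (b : B.Str X) V, (E.obj b V).1.restrict h ≤ V.1) :
    R.functor ⊣ E.functor :=
  FibreFunctor.adjunction R E (fun X b V => (hE X b _).1 (hR X b V).ge)
    fun X b V => (hR X b _).trans_le (hle b V)

/-- Restriction is right adjoint to a meet extension which does not shrink restrictions. -/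
def IsMeetExtension.adjunction (hE : E.IsMeetExtension h) (hR : R.IsRestriction h)
    (hle : ∀ ⦃X : Type u⦄ (b : B.Str X) V, V.1 ≤ (E.obj b V).1.restrict h) :
    E.functor ⊣ R.functor :=
  FibreFunctor.adjunction E R (fun X b V => (hle b V).trans_eq (hR X b _).symm)
    fun X b V => (hE X b _).1 (hR X b V).le

theorem isRestrictionExtensionIso (hR : R.IsRestriction h) (hjoin : E.IsJoinExtension h)
    (hmeet : E.IsMeetExtension h)
    (hRE : ∀ ⦃X : Type u⦄ (b : B.Str X) V, (E.obj b V).1.restrict h = V.1) :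
    R.IsRestrictionExtensionIso E h := by
  refine ⟨hR, hjoin, hmeet, functor_eq_id (R.comp E) fun X b V => ?_,
    functor_eq_id (E.comp R) fun X b V => Subtype.ext ((hR X b _).trans (hRE b V))⟩
  exact le_antisymm ((hmeet X b _).1 (hR X b V).le) ((hjoin X b _).1 (hR X b V).ge)

/-- The equivalence of categories given by restriction and its inverse. -/
def IsRestrictionExtensionIso.equivalence (hRE : R.IsRestrictionExtensionIso E h) :
    Space P ≌ Space Q :=
  CategoryTheory.Equivalence.mk R.functor E.functor (eqToIso hRE.2.2.2.1.symm) (eqToIso hRE.2.2.2.2)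

theorem IsRestrictionExtensionIso.full_restriction (hRE : R.IsRestrictionExtensionIso E h) :
    R.functor.Full :=
  inferInstanceAs hRE.equivalence.functor.Full

theorem IsRestrictionExtensionIso.full_extension (hRE : R.IsRestrictionExtensionIso E h) :
    E.functor.Full :=
  inferInstanceAs hRE.equivalence.inverse.Full

end FibreFunctor

end FibreFunctors

/-! ### Regular underlying categories -/

/-- The morphisms of the underlying category can be composed with the morphisms from and to test
spaces, these can be composed with each other and with smooth maps, and constant maps are morphisms
from test spaces. -/
class Underlying.IsRegular (B : Underlying.{u}) : Prop where
  in_comp : ∀ {X : Type u} {b : B.Str X} {S T : TestSpace} {f : S → T} {i : T → X},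
    IsSmooth f → i ∈ B.inMor b T → i ∘ f ∈ B.inMor b S
  out_comp : ∀ {X : Type u} {b : B.Str X} {S T : TestSpace} {f : S → T} {o : X → S},
    IsSmooth f → o ∈ B.outMor b S → f ∘ o ∈ B.outMor b T
  mor_in : ∀ {X Y : Type u} {b : B.Str X} {c : B.Str Y} {f : X → Y} {S : TestSpace} {i : S → X},
    f ∈ B.mor b c → i ∈ B.inMor b S → f ∘ i ∈ B.inMor c S
  mor_out : ∀ {X Y : Type u} {b : B.Str X} {c : B.Str Y} {f : X → Y} {S : TestSpace} {o : Y → S},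
    f ∈ B.mor b c → o ∈ B.outMor c S → o ∘ f ∈ B.outMor b S
  in_out : ∀ {X : Type u} {b : B.Str X} {S T : TestSpace} {i : S → X} {o : X → T},
    i ∈ B.inMor b S → o ∈ B.outMor b T → o ∘ i ∈ B.testMor S T
  const_in : ∀ {X : Type u} (b : B.Str X) (S : TestSpace) (x : X), (fun _ => x) ∈ B.inMor b S

instance : sets.{u}.IsRegular where
  in_comp _ _ := trivial
  out_comp _ _ := trivial
  mor_in _ _ := trivial
  mor_out _ _ := trivial
  in_out _ _ := trivial
  const_in _ _ _ := trivial

instance : topologicalSpaces.{u}.IsRegular where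
  in_comp {_ b _ _ _ _} hf hi := @Continuous.comp _ _ _ _ _ b _ _ hi hf.continuous
  out_comp {_ b _ _ _ _} hf ho := @Continuous.comp _ _ _ b _ _ _ _ hf.continuous ho
  mor_in {_ _ b c _ _ _} hf hi := @Continuous.comp _ _ _ _ b c _ _ hf hi
  mor_out {_ _ b c _ _ _} hf ho := @Continuous.comp _ _ _ b c _ _ _ ho hf
  in_out {_ b _ _ _ _} hi ho := @Continuous.comp _ _ _ _ b _ _ _ ho hi
  const_in b _ x := @continuous_const _ _ _ b x

/-! ### Forcing conditions -/

section Conditions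

variable {B : Underlying.{u}} {𝒮 𝒯 : Set TestSpace} {X : Type u} {b : B.Str X}
  {V : VirtualStr B 𝒯 b}

theorem inTerm_iff_const_mem [B.IsRegular] (hline : realLine ∈ 𝒯) (hpoint : pointTest ∈ 𝒯) :
    InTerm b V ↔ ∀ (S : 𝒯) (x : X), (fun _ => x) ∈ V.inp S := by
  refine ⟨fun hV S x => ?_, fun h S hS i _ => ?_⟩
  · exact V.inp_comp (T := ⟨pointTest, hpoint⟩) (isSmooth_const ⟨0, Set.mem_univ _⟩)
      (hV ⟨pointTest, hpoint⟩ (isTerminalTest_pointTest 𝒯)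
        (Underlying.IsRegular.const_in b pointTest x))
  · have := hS.subsingleton hline
    obtain ⟨s⟩ := hS.nonempty hline
    have hconst : (fun _ => i s) = i := funext fun t => congrArg i (Subsingleton.elim s t)
    exact hconst ▸ h S (i s)

theorem InSat.inSheaf (hV : InSat b V) : InSheaf b V := fun S i hi hlocal =>
  hV S i hi fun _ _ ho => isSmooth_of_locally fun x =>
    let ⟨U, hU, hx, _, hUi⟩ := hlocal x
    ⟨U, hU, hx, V.compat hUi ho⟩

theorem InSat.inTerm (hline : realLine ∈ 𝒯) (hV : InSat b V) : InTerm b V := fun S hS i hi =>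
  have := hS.subsingleton hline
  hV S i hi fun _ _ _ => isSmooth_of_forall_eq fun x y => congrArg _ (Subsingleton.elim x y)

theorem OutSat.outTerm (hline : realLine ∈ 𝒯) (hV : OutSat b V) : OutTerm b V := fun T hT o ho =>
  have := hT.subsingleton hline
  hV T o ho fun _ _ _ => isSmooth_of_forall_eq fun _ _ => Subsingleton.elim _ _

theorem OutSat.outDetCoord (h : lineTests ⊆ 𝒯) (hV : OutSat b V) : OutDetCoord h b V :=
  fun T o ho hcoord => hV T o ho fun _ _ hi =>
    isSmooth_of_coordinates fun j => V.compat hi (hcoord j)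

theorem OutSat.outSheaf {b : topologicalSpaces.Str X} {V : VirtualStr topologicalSpaces 𝒯 b}
    (hV : OutSat b V) : OutSheaf b V := by
  refine fun T o ho hlocal => hV T o ho fun S i hi => isSmooth_of_locally fun x => ?_
  obtain ⟨U, hU, hxU, g, hg, hog⟩ := hlocal (i x)
  obtain ⟨U', hU', hpre⟩ := isOpen_induced_iff.1 (@IsOpen.preimage _ _ _ b i (V.inp_mor S hi) U hU)
  have hmem (y : S.1) : (y : Euc S.1.dim) ∈ U' ↔ i y ∈ U := Set.ext_iff.1 hpre y
  refine ⟨U', hU', (hmem x).2 hxU, ?_⟩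
  have heq : (o ∘ i) ∘ cutIncl S.1 U' = (g ∘ i) ∘ cutIncl S.1 U' := funext fun y =>
    hog _ ((hmem (cutIncl S.1 U' y)).1 y.2.2)
  exact heq ▸ (V.compat hi hg).comp (isSmooth_cutIncl _ _)

/-! ### Restriction of forcing conditions -/

theorem InSat.restrict (hline : realLine ∈ 𝒮) (h : 𝒮 ⊆ 𝒯) (hV : InSat b V) :
    InSat b (V.restrict h) := fun S i hi hsmooth =>
  hV ⟨S.1, h S.2⟩ i hi fun T _ ho => isSmooth_of_coordinates fun j =>
    hsmooth ⟨realLine, hline⟩ _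
      (V.out_comp (T := ⟨realLine, h hline⟩) (isSmooth_coordinate T.1 j) ho)

theorem OutSat.restrict (hline : realLine ∈ 𝒮) (hcurve : ∀ T ∈ 𝒯, CurveDetermined T) (h : 𝒮 ⊆ 𝒯)
    (hV : OutSat b V) : OutSat b (V.restrict h) := fun T o ho hsmooth =>
  hV ⟨T.1, h T.2⟩ o ho fun S _ hi => hcurve S.1 S.2 fun _ hc =>
    hsmooth ⟨realLine, hline⟩ _ (V.inp_comp (S := ⟨realLine, h hline⟩) hc hi)

theorem InSheaf.restrict (h : 𝒮 ⊆ 𝒯) (hV : InSheaf b V) : InSheaf b (V.restrict h) :=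
  fun S i hi hlocal => hV ⟨S.1, h S.2⟩ i hi fun x =>
    let ⟨U, hU, hxU, hcut, hUi⟩ := hlocal x
    ⟨U, hU, hxU, h hcut, hUi⟩

theorem InTerm.restrict [B.IsRegular] (hline : realLine ∈ 𝒮) (hpoint : pointTest ∈ 𝒮) (h : 𝒮 ⊆ 𝒯)
    (hV : InTerm b V) : InTerm b (V.restrict h) :=
  (inTerm_iff_const_mem hline hpoint).2 fun S =>
    (inTerm_iff_const_mem (h hline) (h hpoint)).1 hV ⟨S.1, h S.2⟩

end Conditions

/-! ### Forcing saturation -/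

section Saturation

variable {B : Underlying.{u}} [B.IsRegular] {𝒯 : Set TestSpace} {X : Type u} {b : B.Str X}

open Underlying.IsRegular

/-- The structure with the given outputs and all inputs which are smooth along them. -/
def saturateInp (V : VirtualStr B 𝒯 b) : VirtualStr B 𝒯 b where
  inp S := {i | i ∈ B.inMor b S.1 ∧ ∀ T, ∀ o ∈ V.out T, IsSmooth (o ∘ i)}
  out := V.out
  inp_mor _ _ hi := hi.1
  out_mor := V.out_mor
  inp_comp hf hi := ⟨in_comp hf hi.1, fun T o ho => (hi.2 T o ho).comp hf⟩
  out_comp := V.out_comp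
  compat {_ T _ _} hi ho := hi.2 T _ ho

theorem le_saturateInp (V : VirtualStr B 𝒯 b) : V ≤ saturateInp V :=
  ⟨fun S _ hi => ⟨V.inp_mor S hi, fun _ _ ho => V.compat hi ho⟩, fun _ => subset_rfl⟩

theorem inSat_saturateInp (V : VirtualStr B 𝒯 b) : InSat b (saturateInp V) :=
  fun _ _ hi hsmooth => ⟨hi, hsmooth⟩

theorem OutSat.saturateInp {V : VirtualStr B 𝒯 b} (hV : OutSat b V) : OutSat b (saturateInp V) :=
  fun T o ho hsmooth => hV T o ho fun S i hi => hsmooth S i ((le_saturateInp V).1 S hi)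

/-- The structure with the given inputs and all outputs which are smooth along them. -/
def saturateOut (V : VirtualStr B 𝒯 b) : VirtualStr B 𝒯 b where
  inp := V.inp
  out T := {o | o ∈ B.outMor b T.1 ∧ ∀ S, ∀ i ∈ V.inp S, IsSmooth (o ∘ i)}
  inp_mor := V.inp_mor
  out_mor _ _ ho := ho.1
  inp_comp := V.inp_comp
  out_comp hf ho := ⟨out_comp hf ho.1, fun S i hi => hf.comp (ho.2 S i hi)⟩
  compat {S _ _ _} hi ho := ho.2 S _ hi

theorem saturateOut_le (V : VirtualStr B 𝒯 b) : saturateOut V ≤ V :=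
  ⟨fun _ => subset_rfl, fun T _ ho => ⟨V.out_mor T ho, fun _ _ hi => V.compat hi ho⟩⟩

theorem outSat_saturateOut (V : VirtualStr B 𝒯 b) : OutSat b (saturateOut V) :=
  fun _ _ ho hsmooth => ⟨ho, hsmooth⟩

theorem InSat.saturateOut {V : VirtualStr B 𝒯 b} (hV : InSat b V) : InSat b (saturateOut V) :=
  fun S i hi hsmooth => hV S i hi fun T o ho => hsmooth T o ((saturateOut_le V).2 T ho)

namespace FibreFunctor

/-- The meet forcing functor from output saturated structures to saturated structures. -/
def meetForcing (P : Condition B 𝒯) (hP : P ≤ OutSat) :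
    FibreFunctor P (InSat ⊓ OutSat : Condition B 𝒯) where
  obj _ b V := ⟨saturateInp V.1, inSat_saturateInp V.1, (hP _ b V.1 V.2).saturateInp⟩
  map _ _ _ _ _ _ _ hf := ⟨hf.1,
    fun _ _ hi => ⟨mor_in hf.1 hi.1, fun T _ ho => hi.2 T _ (hf.2.2 T _ ho)⟩, hf.2.2⟩

theorem isMeetForcing_meetForcing (P : Condition B 𝒯) (hP : P ≤ OutSat) :
    (meetForcing P hP).IsMeetForcing := fun _ _ V =>
  ⟨fun W hW => ⟨fun S i hi => W.2.1 S i hi.1 fun T o ho => hi.2 T o (hW.2 T ho), hW.2⟩,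
    fun _ hW => hW (le_saturateInp V.1)⟩

/-- Meet forcing is left adjoint to the inclusion. -/
def meetForcingAdjunction (P : Condition B 𝒯) (hP : P ≤ OutSat) (hsat : InSat ⊓ OutSat ≤ P) :
    (meetForcing P hP).functor ⊣ (inclusion (InSat ⊓ OutSat) P hsat).functor :=
  adjunction _ _ (fun _ _ V => le_saturateInp V.1)
    fun _ b W => (isMeetForcing_meetForcing P hP _ b _).1 (le_refl W.1)

/-- The join forcing functor from input saturated structures to saturated structures. -/
def joinForcing (P : Condition B 𝒯) (hP : P ≤ InSat) :
    FibreFunctor P (InSat ⊓ OutSat : Condition B 𝒯) where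
  obj _ b V := ⟨saturateOut V.1, (hP _ b V.1 V.2).saturateOut, outSat_saturateOut V.1⟩
  map _ _ _ _ _ _ _ hf := ⟨hf.1, hf.2.1,
    fun _ _ ho => ⟨mor_out hf.1 ho.1, fun S _ hi => ho.2 S _ (hf.2.1 S _ hi)⟩⟩

theorem isJoinForcing_joinForcing (P : Condition B 𝒯) (hP : P ≤ InSat) :
    (joinForcing P hP).IsJoinForcing := fun _ _ V =>
  ⟨fun W hW => ⟨hW.1, fun T o ho => W.2.2 T o ho.1 fun S i hi => ho.2 S i (hW.1 S hi)⟩,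
    fun _ hW => hW (saturateOut_le V.1)⟩

/-- Join forcing is right adjoint to the inclusion. -/
def joinForcingAdjunction (P : Condition B 𝒯) (hP : P ≤ InSat) (hsat : InSat ⊓ OutSat ≤ P) :
    (inclusion (InSat ⊓ OutSat) P hsat).functor ⊣ (joinForcing P hP).functor :=
  adjunction _ _ (fun _ b V => (isJoinForcing_joinForcing P hP _ b _).1 (le_refl V.1))
    fun _ _ W => saturateOut_le W.1

end FibreFunctor

end Saturation

/-! ### Extension by probing -/

section Probe

variable {B : Underlying.{u}} [B.IsRegular] {𝒮 𝒯 : Set TestSpace}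
  (hline : realLine ∈ 𝒮) (hcurve : ∀ T ∈ 𝒯, CurveDetermined T)
  {X : Type u} {b : B.Str X} {V : VirtualStr B 𝒮 b}

open Underlying.IsRegular

/-- The extension to `𝒯` of a structure with test spaces in `𝒮` whose inputs are the maps which
become inputs when probed by smooth maps from members of `𝒮`, and whose outputs are the maps which
are smooth along the given inputs. -/
def probe (V : VirtualStr B 𝒮 b) : VirtualStr B 𝒯 b where
  inp S := {i | i ∈ B.inMor b S.1 ∧ ∀ (C : 𝒮) (f : C.1 → S.1), IsSmooth f → i ∘ f ∈ V.inp C}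
  out T := {o | o ∈ B.outMor b T.1 ∧ ∀ C, ∀ i ∈ V.inp C, IsSmooth (o ∘ i)}
  inp_mor _ _ hi := hi.1
  out_mor _ _ ho := ho.1
  inp_comp hf hi := ⟨in_comp hf hi.1, fun C _ hg => hi.2 C _ (hf.comp hg)⟩
  out_comp hf ho := ⟨out_comp hf ho.1, fun C i hi => hf.comp (ho.2 C i hi)⟩
  compat {S _ _ _} hi ho := hcurve S.1 S.2 fun c hc =>
    ho.2 ⟨realLine, hline⟩ _ (hi.2 ⟨realLine, hline⟩ c hc)

theorem IsMor.probe {Y : Type u} {c : B.Str Y} {W : VirtualStr B 𝒮 c} {f : X → Y}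
    (hf : IsMor V W f) : IsMor (probe hline hcurve V) (probe hline hcurve W) f :=
  ⟨hf.1, fun _ _ hi => ⟨mor_in hf.1 hi.1, fun C g hg => hf.2.1 C _ (hi.2 C g hg)⟩,
    fun _ _ ho => ⟨mor_out hf.1 ho.1, fun C _ hi => ho.2 C _ (hf.2.1 C _ hi)⟩⟩

theorem mem_probe_inp (h : 𝒮 ⊆ 𝒯) {C : 𝒮} {i : C.1 → X} :
    i ∈ (probe hline hcurve V).inp ⟨C.1, h C.2⟩ ↔ i ∈ V.inp C :=
  ⟨fun hi => hi.2 C id (isSmooth_id C.1),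
    fun hi => ⟨V.inp_mor C hi, fun _ _ hf => V.inp_comp hf hi⟩⟩

theorem subset_probe_out (h : 𝒮 ⊆ 𝒯) (T : 𝒮) :
    V.out T ⊆ (probe hline hcurve V).out ⟨T.1, h T.2⟩ :=
  fun _ ho => ⟨V.out_mor T ho, fun _ _ hi => V.compat hi ho⟩

theorem restrict_probe_le (h : 𝒮 ⊆ 𝒯) : (probe hline hcurve V).restrict h ≤ V :=
  ⟨fun _ _ hi => (mem_probe_inp hline hcurve h).1 hi, subset_probe_out hline hcurve h⟩

theorem restrict_probe (h : 𝒮 ⊆ 𝒯) (hV : OutSat b V) : (probe hline hcurve V).restrict h = V :=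
  (restrict_probe_le hline hcurve h).antisymm
    ⟨fun _ _ hi => (mem_probe_inp hline hcurve h).2 hi, fun T o ho => hV T o ho.1 ho.2⟩

theorem outSat_probe (h : 𝒮 ⊆ 𝒯) : OutSat b (probe hline hcurve V) := fun _ _ ho hsmooth =>
  ⟨ho, fun C i hi => hsmooth ⟨C.1, h C.2⟩ i ((mem_probe_inp hline hcurve h).2 hi)⟩

theorem InSat.probe (h : 𝒮 ⊆ 𝒯) (hV : InSat b V) : InSat b (probe hline hcurve V) :=
  fun _ _ hi hsmooth => ⟨hi, fun C _ hf => hV C _ (in_comp hf hi) fun T o ho =>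
    (hsmooth ⟨T.1, h T.2⟩ o (subset_probe_out hline hcurve h T ho)).comp hf⟩

theorem InTerm.probe (h : 𝒮 ⊆ 𝒯) (hpoint : pointTest ∈ 𝒮) (hV : InTerm b V) :
    InTerm b (probe hline hcurve V) :=
  (inTerm_iff_const_mem (h hline) (h hpoint)).2 fun S x =>
    ⟨const_in b S.1 x, fun C _ _ => (inTerm_iff_const_mem hline hpoint).1 hV C x⟩

theorem InSheaf.probe (hcuts : HasSmallCuts 𝒮) (hV : InSheaf b V) :
    InSheaf b (probe hline hcurve V) := by
  refine fun S i hi hlocal => ⟨hi, fun C f hf => hV C _ (in_comp hf hi) fun x => ?_⟩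
  obtain ⟨U, hU, hxU, _, hUi⟩ := hlocal (f x)
  obtain ⟨U', hU', hmem⟩ := hf.exists_isOpen_preimage hU
  obtain ⟨W, hWU', hW, hxW, hcut⟩ := hcuts C.1 C.2 x U' hU' ((hmem x).2 hxU)
  have hWU (y : C.1.cut W) : (f (cutIncl C.1 W y) : Euc S.1.dim) ∈ U :=
    (hmem (cutIncl C.1 W y)).1 (hWU' y.2.2)
  exact ⟨W, hW, hxW, hcut,
    hUi.2 ⟨_, hcut⟩ (cutMk _ hWU) ((hf.comp (isSmooth_cutIncl C.1 W)).cutMk hWU)⟩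

namespace FibreFunctor

variable {P : Condition B 𝒮} {Q : Condition B 𝒯}

/-- Extension by probing, as a functor. -/
def probeExtension
    (hPQ : ∀ ⦃X : Type u⦄ (b : B.Str X) (V : VirtualStr B 𝒮 b),
      P b V → Q b (probe hline hcurve V)) : FibreFunctor P Q where
  obj _ b V := ⟨probe hline hcurve V.1, hPQ b V.1 V.2⟩
  map _ _ _ _ _ _ _ hf := hf.probe hline hcurve

variable (h : 𝒮 ⊆ 𝒯) (hPQ : ∀ ⦃X : Type u⦄ (b : B.Str X) (V : VirtualStr B 𝒮 b),
  P b V → Q b (probe hline hcurve V))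

theorem isJoinExtension_probeExtension (hQ : Q ≤ OutSat) :
    (probeExtension hline hcurve hPQ).IsJoinExtension h := by
  refine fun X b V => ⟨fun W hW => ?_, fun W hW => hW (restrict_probe_le hline hcurve h)⟩
  have hinp (S) : W.1.inp S ⊆ (probe hline hcurve V.1).inp S := fun i hi =>
    ⟨W.1.inp_mor S hi, fun C f hf => hW.1 C (W.1.inp_comp (S := ⟨C.1, h C.2⟩) hf hi)⟩
  exact ⟨hinp, fun T o ho => hQ _ b W.1 W.2 T o ho.1 fun S i hi =>
    (probe hline hcurve V.1).compat (hinp S hi) ho⟩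

theorem isMeetExtension_probeExtension (hP : P ≤ OutSat)
    (hinp : ∀ ⦃X : Type u⦄ (b : B.Str X) (V : VirtualStr B 𝒮 b) (W : VirtualStr B 𝒯 b), Q b W →
      V ≤ W.restrict h → ∀ S, (probe hline hcurve V).inp S ⊆ W.inp S) :
    (probeExtension hline hcurve hPQ).IsMeetExtension h := fun _ b V =>
  ⟨fun W hW => ⟨hinp b V.1 W.1 W.2 hW, fun T _ ho =>
      ⟨W.1.out_mor T ho, fun C _ hi => W.1.compat (hW.1 C hi) ho⟩⟩,
    fun _ hW => hW (restrict_probe hline hcurve h (hP _ b V.1 V.2)).ge⟩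

theorem full_probeExtension (h : 𝒮 ⊆ 𝒯) (hP : P ≤ OutSat) :
    (probeExtension hline hcurve hPQ).functor.Full :=
  full_of_restrict_obj (h := h) fun _ b V => restrict_probe hline hcurve h (hP _ b V.1 V.2)

end FibreFunctor

variable {W : VirtualStr B 𝒯 b}

theorem InSat.probe_inp_subset (h : 𝒮 ⊆ 𝒯) (hW : InSat b W) (hVW : V ≤ W.restrict h) (S : 𝒯) :
    (SmoothSpaces.probe hline hcurve V).inp S ⊆ W.inp S := fun i hi =>
  hW S i hi.1 fun _ _ ho => hcurve S.1 S.2 fun c hc =>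
    W.compat (hVW.1 ⟨realLine, hline⟩ (hi.2 ⟨realLine, hline⟩ c hc)) ho

theorem InSheaf.probe_inp_subset (h : 𝒮 ⊆ 𝒯) (hW : InSheaf b W) (hVW : V ≤ W.restrict h)
    (hcover : ∀ S ∈ 𝒯, ∀ x : S, ∃ U : Set (Euc S.dim),
      IsOpen U ∧ (x : Euc S.dim) ∈ U ∧ S.cut U ∈ 𝒮) (S : 𝒯) :
    (SmoothSpaces.probe hline hcurve V).inp S ⊆ W.inp S := fun i hi =>
  hW S i hi.1 fun x =>
    let ⟨U, hU, hxU, hcut⟩ := hcover S.1 S.2 x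
    ⟨U, hU, hxU, h hcut,
      hVW.1 ⟨_, hcut⟩ (hi.2 ⟨_, hcut⟩ (cutIncl S.1 U) (isSmooth_cutIncl S.1 U))⟩

namespace FibreFunctor

/-- Restriction of saturated structures to a smaller test category. -/
abbrev saturatedRestriction (h : 𝒮 ⊆ 𝒯) :
    FibreFunctor (InSat ⊓ OutSat : Condition B 𝒯) (InSat ⊓ OutSat : Condition B 𝒮) :=
  restriction _ _ h fun _ _ _ hV =>
    ⟨InSat.restrict hline h hV.1, OutSat.restrict hline hcurve h hV.2⟩

/-- Extension of saturated structures to a larger test category. -/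
abbrev saturatedExtension (h : 𝒮 ⊆ 𝒯) :
    FibreFunctor (InSat ⊓ OutSat : Condition B 𝒮) (InSat ⊓ OutSat : Condition B 𝒯) :=
  probeExtension hline hcurve fun _ _ _ hV =>
    ⟨InSat.probe hline hcurve h hV.1, outSat_probe hline hcurve h⟩

theorem isRestrictionExtensionIso_saturated (h : 𝒮 ⊆ 𝒯) :
    (saturatedRestriction (B := B) hline hcurve h).IsRestrictionExtensionIso
      (saturatedExtension hline hcurve h) h :=
  isRestrictionExtensionIso (fun _ _ _ => rfl)
    (isJoinExtension_probeExtension hline hcurve h _ fun _ _ _ hV => hV.2)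
    (isMeetExtension_probeExtension hline hcurve h _ (fun _ _ _ hV => hV.2)
      fun _ _ _ _ hW hVW => InSat.probe_inp_subset hline hcurve h hW.1 hVW)
    fun _ _ V => restrict_probe hline hcurve h V.2.2

end FibreFunctor

end Probe

/-! ### Extension by germs -/

section Germs

variable {B : Underlying.{u}} {𝒮 𝒯 : Set TestSpace} {X : Type u} {b : B.Str X}
  {V : VirtualStr B 𝒮 b} {S T : TestSpace}

/-- Near every point of the test space `S`, the map `i` factors through an input of `V` by a smooth
map. -/
def FactorsLocally (V : VirtualStr B 𝒮 b) (i : S → X) : Prop :=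
  ∀ x : S, ∃ U : Set (Euc S.dim), IsOpen U ∧ (x : Euc S.dim) ∈ U ∧
    ∃ (C : 𝒮) (f : S.cut U → C.1) (j : C.1 → X), IsSmooth f ∧ j ∈ V.inp C ∧
      i ∘ cutIncl S U = j ∘ f

theorem factorsLocally_of_mem_inp {C : 𝒮} {i : C.1 → X} (hi : i ∈ V.inp C) : FactorsLocally V i :=
  fun _ => ⟨Set.univ, isOpen_univ, Set.mem_univ _, C, cutIncl C.1 _, i, isSmooth_cutIncl _ _, hi,
    rfl⟩

theorem FactorsLocally.comp_isSmooth {f : S → T} {i : T → X} (hi : FactorsLocally V i)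
    (hf : IsSmooth f) : FactorsLocally V (i ∘ f) := by
  intro x
  obtain ⟨U, hU, hxU, C, g, j, hg, hj, heq⟩ := hi (f x)
  obtain ⟨U', hU', hmem⟩ := hf.exists_isOpen_preimage hU
  have hmaps (y : S.cut U') : (f (cutIncl S U' y) : Euc T.dim) ∈ U :=
    (hmem (cutIncl S U' y)).1 y.2.2
  exact ⟨U', hU', (hmem x).2 hxU, C, g ∘ cutMk _ hmaps, j,
    hg.comp ((hf.comp (isSmooth_cutIncl S U')).cutMk hmaps), hj,
    funext fun y => congrFun heq (cutMk _ hmaps y)⟩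

theorem FactorsLocally.isMor_comp {Y : Type u} {c : B.Str Y} {W : VirtualStr B 𝒮 c} {k : X → Y}
    {i : S → X} (hi : FactorsLocally V i) (hk : IsMor V W k) : FactorsLocally W (k ∘ i) :=
  fun x =>
    let ⟨U, hU, hxU, C, f, j, hf, hj, heq⟩ := hi x
    ⟨U, hU, hxU, C, f, k ∘ j, hf, hk.2.1 C j hj, congrArg (k ∘ ·) heq⟩

theorem FactorsLocally.isSmooth_comp {i : S → X} {o : X → T} (hi : FactorsLocally V i)
    (ho : ∀ C, ∀ j ∈ V.inp C, IsSmooth (o ∘ j)) : IsSmooth (o ∘ i) :=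
  isSmooth_of_locally fun x =>
    let ⟨U, hU, hxU, C, _, j, hf, hj, heq⟩ := hi x
    ⟨U, hU, hxU, (congrArg (o ∘ ·) heq : o ∘ i ∘ cutIncl S U = _) ▸ (ho C j hj).comp hf⟩

theorem factorsLocally_of_locally {i : S → X}
    (h : ∀ x : S, ∃ U : Set (Euc S.dim), IsOpen U ∧ (x : Euc S.dim) ∈ U ∧
      FactorsLocally V (i ∘ cutIncl S U)) : FactorsLocally V i := by
  intro x
  obtain ⟨U, hU, hxU, hi⟩ := h x
  obtain ⟨U', hU', hxU', C, f, j, hf, hj, heq⟩ := hi ⟨x.1, x.2, hxU⟩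
  let g : S.cut (U ∩ U') → (S.cut U).cut U' := fun y => ⟨y.1, ⟨y.2.1, y.2.2.1⟩, y.2.2.2⟩
  have hg : IsSmooth g := isSmooth_of_contDiff (S := S.cut (U ∩ U')) id contDiff_id fun _ => rfl
  exact ⟨U ∩ U', hU.inter hU', ⟨hxU, hxU'⟩, C, f ∘ g, j, hf.comp hg, hj,
    funext fun y => congrFun heq (g y)⟩

theorem FactorsLocally.mem_inp {W : VirtualStr B 𝒯 b} (h : 𝒮 ⊆ 𝒯) (hcuts : HasSmallCuts 𝒯)
    (hW : InSheaf b W) (hVW : ∀ C : 𝒮, V.inp C ⊆ W.inp ⟨C.1, h C.2⟩) {S : 𝒯} {i : S.1 → X}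
    (hmor : i ∈ B.inMor b S.1) (hi : FactorsLocally V i) : i ∈ W.inp S := by
  refine hW S i hmor fun x => ?_
  obtain ⟨U, hU, hxU, C, f, j, hf, hj, heq⟩ := hi x
  obtain ⟨U', hU'U, hU', hxU', hcut⟩ := hcuts S.1 S.2 x U hU hxU
  let incl : S.1.cut U' → S.1.cut U := cutMk (cutIncl S.1 U') fun y => hU'U y.2.2
  have hincl : IsSmooth incl := (isSmooth_cutIncl S.1 U').cutMk _
  have hfactor : (fun y : S.1.cut U' => i ⟨y.1, y.2.1⟩) = j ∘ f ∘ incl :=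
    funext fun y => congrFun heq (incl y)
  exact ⟨U', hU', hxU', hcut, hfactor ▸
    W.inp_comp (S := ⟨_, hcut⟩) (T := ⟨C.1, h C.2⟩) (hf.comp hincl) (hVW C hj)⟩

variable [B.IsRegular]

open Underlying.IsRegular

/-- The extension to `𝒯` of a structure with test spaces in `𝒮` whose inputs are the maps which
factor locally through the given inputs, and whose outputs are the maps which are smooth along the
given inputs. -/
def germ (𝒯 : Set TestSpace) (V : VirtualStr B 𝒮 b) : VirtualStr B 𝒯 b where
  inp S := {i | i ∈ B.inMor b S.1 ∧ FactorsLocally V i}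
  out T := {o | o ∈ B.outMor b T.1 ∧ ∀ C, ∀ i ∈ V.inp C, IsSmooth (o ∘ i)}
  inp_mor _ _ hi := hi.1
  out_mor _ _ ho := ho.1
  inp_comp hf hi := ⟨in_comp hf hi.1, hi.2.comp_isSmooth hf⟩
  out_comp hf ho := ⟨out_comp hf ho.1, fun C i hi => hf.comp (ho.2 C i hi)⟩
  compat hi ho := hi.2.isSmooth_comp ho.2

theorem le_restrict_germ (h : 𝒮 ⊆ 𝒯) (hV : OutSat b V) : V ≤ (germ 𝒯 V).restrict h :=
  ⟨fun C _ hi => ⟨V.inp_mor C hi, factorsLocally_of_mem_inp hi⟩, fun T o ho => hV T o ho.1 ho.2⟩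

theorem restrict_germ (h : 𝒮 ⊆ 𝒯) (hcuts : HasSmallCuts 𝒮) (hsheaf : InSheaf b V)
    (hsat : OutSat b V) : (germ 𝒯 V).restrict h = V :=
  .symm <| (le_restrict_germ h hsat).antisymm
    ⟨fun _ _ hi => hi.2.mem_inp subset_rfl hcuts hsheaf (fun _ => subset_rfl) hi.1,
      fun T _ ho => ⟨V.out_mor T ho, fun _ _ hi => V.compat hi ho⟩⟩

theorem outSat_germ (h : 𝒮 ⊆ 𝒯) : OutSat b (germ 𝒯 V) := fun _ _ ho hsmooth =>
  ⟨ho, fun C i hi => hsmooth ⟨C.1, h C.2⟩ i ⟨V.inp_mor C hi, factorsLocally_of_mem_inp hi⟩⟩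

theorem inSheaf_germ : InSheaf b (germ 𝒯 V) := fun _ _ hi hlocal =>
  ⟨hi, factorsLocally_of_locally fun x =>
    let ⟨U, hU, hxU, _, hUi⟩ := hlocal x
    ⟨U, hU, hxU, hUi.2⟩⟩

theorem InTerm.germ (hline : realLine ∈ 𝒮) (hpoint : pointTest ∈ 𝒮) (h : 𝒮 ⊆ 𝒯)
    (hV : InTerm b V) : InTerm b (germ 𝒯 V) :=
  (inTerm_iff_const_mem (h hline) (h hpoint)).2 fun S x =>
    have hx := (inTerm_iff_const_mem hline hpoint).1 hV ⟨pointTest, hpoint⟩ x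
    ⟨const_in b S.1 x, (factorsLocally_of_mem_inp hx).comp_isSmooth
      (isSmooth_const (⟨0, Set.mem_univ _⟩ : pointTest))⟩

namespace FibreFunctor

variable {P : Condition B 𝒮} {Q : Condition B 𝒯}

/-- Extension by germs, as a functor. -/
def germExtension (hPQ : ∀ ⦃X : Type u⦄ (b : B.Str X) (V : VirtualStr B 𝒮 b),
    P b V → Q b (germ 𝒯 V)) : FibreFunctor P Q where
  obj _ b V := ⟨germ 𝒯 V.1, hPQ b V.1 V.2⟩
  map _ _ _ _ _ _ _ hf := ⟨hf.1, fun _ _ hi => ⟨mor_in hf.1 hi.1, hi.2.isMor_comp hf⟩,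
    fun _ _ ho => ⟨mor_out hf.1 ho.1, fun C _ hi => ho.2 C _ (hf.2.1 C _ hi)⟩⟩

theorem isMeetExtension_germExtension (h : 𝒮 ⊆ 𝒯) (hcuts : HasSmallCuts 𝒯) (hP : P ≤ OutSat)
    (hQ : Q ≤ InSheaf) (hPQ : ∀ ⦃X : Type u⦄ (b : B.Str X) (V : VirtualStr B 𝒮 b),
      P b V → Q b (germ 𝒯 V)) : (germExtension hPQ).IsMeetExtension h := fun _ b V =>
  ⟨fun W hW => ⟨fun _ _ hi => hi.2.mem_inp h hcuts (hQ _ b W.1 W.2) hW.1 hi.1,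
      fun T _ ho => ⟨W.1.out_mor T ho, fun C _ hi => W.1.compat (hW.1 C hi) ho⟩⟩,
    fun _ hW => hW (le_restrict_germ h (hP _ b V.1 V.2))⟩

end FibreFunctor

end Germs

/-! ### Frölicher, Souriau and Chen spaces -/

section Diffeological

open FibreFunctor

/-- Diffeological spaces with test spaces in `𝒯`; Souriau and Chen spaces are the cases of open and
of convex test spaces. -/
abbrev diffeological (𝒯 : Set TestSpace) : Condition sets.{u} 𝒯 := InSheaf ⊓ InTerm ⊓ OutSat

theorem curveDetermined_of_mem_openTests : ∀ T ∈ openTests, CurveDetermined T :=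
  fun _ => curveDetermined_of_open

theorem curveDetermined_of_mem_convexTests : ∀ T ∈ convexTests, CurveDetermined T :=
  fun _ => curveDetermined_of_convex

theorem realLine_mem_openConvexTests : realLine ∈ openConvexTests := line_subset_openConvex rfl

variable {𝒯 : Set TestSpace} (hcurve : ∀ T ∈ 𝒯, CurveDetermined T) (h : openConvexTests ⊆ 𝒯)

/-- Restriction of diffeological spaces to the open convex test spaces. -/
def diffeologicalRestriction :
    FibreFunctor (diffeological.{u} 𝒯) (diffeological openConvexTests) :=
  restriction _ _ h fun _ _ _ hV =>
    ⟨⟨InSheaf.restrict h hV.1.1,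
        InTerm.restrict realLine_mem_openConvexTests pointTest_mem_openConvexTests h hV.1.2⟩,
      OutSat.restrict realLine_mem_openConvexTests hcurve h hV.2⟩

/-- The join extension of diffeological spaces from the open convex test spaces. -/
def diffeologicalJoin : FibreFunctor (diffeological.{u} openConvexTests) (diffeological 𝒯) :=
  probeExtension realLine_mem_openConvexTests hcurve fun _ _ _ hV =>
    ⟨⟨InSheaf.probe _ hcurve hasSmallCuts_openConvexTests hV.1.1,
      InTerm.probe _ hcurve h pointTest_mem_openConvexTests hV.1.2⟩, outSat_probe _ hcurve h⟩

/-- The meet extension of diffeological spaces from the open convex test spaces. -/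
def diffeologicalMeet : FibreFunctor (diffeological.{u} openConvexTests) (diffeological 𝒯) :=
  germExtension fun _ _ _ hV =>
    ⟨⟨inSheaf_germ, InTerm.germ realLine_mem_openConvexTests pointTest_mem_openConvexTests h
      hV.1.2⟩, outSat_germ h⟩

theorem isJoinExtension_diffeologicalJoin :
    (diffeologicalJoin.{u} hcurve h).IsJoinExtension h :=
  isJoinExtension_probeExtension _ hcurve h _ fun _ _ _ hV => hV.2

theorem isMeetExtension_diffeologicalJoin
    (hcover : ∀ S ∈ 𝒯, ∀ x : S, ∃ U : Set (Euc S.dim),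
      IsOpen U ∧ (x : Euc S.dim) ∈ U ∧ S.cut U ∈ openConvexTests) :
    (diffeologicalJoin.{u} hcurve h).IsMeetExtension h :=
  isMeetExtension_probeExtension _ hcurve h _ (fun _ _ _ hV => hV.2) fun _ _ _ _ hW hVW =>
    InSheaf.probe_inp_subset _ hcurve h hW.1.1 hVW hcover

theorem isMeetExtension_diffeologicalMeet (hcuts : HasSmallCuts 𝒯) :
    (diffeologicalMeet.{u} h).IsMeetExtension h :=
  isMeetExtension_germExtension h hcuts (fun _ _ _ hV => hV.2) (fun _ _ _ hV => hV.1.1) _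

theorem restrict_diffeologicalJoin ⦃X : Type u⦄ (b : sets.Str X) (V) :
    ((diffeologicalJoin.{u} hcurve h).obj b V).1.restrict h = V.1 :=
  restrict_probe realLine_mem_openConvexTests hcurve h V.2.2

theorem restrict_diffeologicalMeet ⦃X : Type u⦄ (b : sets.Str X) (V) :
    ((diffeologicalMeet.{u} h).obj b V).1.restrict h = V.1 :=
  restrict_germ h hasSmallCuts_openConvexTests V.2.1.1 V.2.2

/-- Restriction is left adjoint to the join extension. -/
def diffeologicalJoinAdjunction :
    (diffeologicalRestriction.{u} hcurve h).functor ⊣ (diffeologicalJoin hcurve h).functor :=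
  (isJoinExtension_diffeologicalJoin hcurve h).adjunction (fun _ _ _ => rfl)
    fun _ b V => (restrict_diffeologicalJoin hcurve h b V).le

/-- Restriction is right adjoint to the meet extension. -/
def diffeologicalMeetAdjunction (hcuts : HasSmallCuts 𝒯) :
    (diffeologicalMeet h).functor ⊣ (diffeologicalRestriction.{u} hcurve h).functor :=
  (isMeetExtension_diffeologicalMeet h hcuts).adjunction (fun _ _ _ => rfl)
    fun _ b V => (restrict_diffeologicalMeet h b V).ge

/-- Restriction of Souriau spaces to the open convex test spaces. -/
def souriauRestriction : FibreFunctor souriau.{u} souriauConvex.{u} :=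
  diffeologicalRestriction curveDetermined_of_mem_openTests Set.inter_subset_left

/-- The extension of Souriau spaces from the open convex to the open test spaces. -/
def souriauExtension : FibreFunctor souriauConvex.{u} souriau.{u} :=
  diffeologicalJoin curveDetermined_of_mem_openTests Set.inter_subset_left

theorem isRestrictionExtensionIso_souriau :
    souriauRestriction.{u}.IsRestrictionExtensionIso souriauExtension Set.inter_subset_left :=
  isRestrictionExtensionIso (fun _ _ _ => rfl) (isJoinExtension_diffeologicalJoin _ _)
    (isMeetExtension_diffeologicalJoin _ _ fun _ hS x =>
      let ⟨U, _, hU, hxU, hcut⟩ := exists_cut_mem_open_convex hS x isOpen_univ (Set.mem_univ _)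
      ⟨U, hU, hxU, hcut⟩)
    (restrict_diffeologicalJoin _ _)

/-- Restriction of Chen spaces to the open convex test spaces. -/
def chenRestriction : FibreFunctor chen.{u} souriauConvex.{u} :=
  diffeologicalRestriction curveDetermined_of_mem_convexTests Set.inter_subset_right

/-- The meet extension of Souriau spaces to Chen spaces. -/
def chenMeetExtension : FibreFunctor souriauConvex.{u} chen.{u} :=
  diffeologicalMeet Set.inter_subset_right

/-- The join extension of Souriau spaces to Chen spaces. -/
def chenJoinExtension : FibreFunctor souriauConvex.{u} chen.{u} :=
  diffeologicalJoin curveDetermined_of_mem_convexTests Set.inter_subset_right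

theorem isMeetExtension_chenMeetExtension :
    chenMeetExtension.{u}.IsMeetExtension Set.inter_subset_right :=
  isMeetExtension_diffeologicalMeet _ hasSmallCuts_convexTests

theorem isJoinExtension_chenJoinExtension :
    chenJoinExtension.{u}.IsJoinExtension Set.inter_subset_right :=
  isJoinExtension_diffeologicalJoin _ _

theorem full_souriauRestriction_chenMeetExtension :
    (souriauRestriction.{u}.functor ⋙ chenMeetExtension.functor).Full :=
  have := isRestrictionExtensionIso_souriau.{u}.full_restriction
  have : chenMeetExtension.{u}.functor.Full := full_of_restrict_obj (restrict_diffeologicalMeet _)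
  inferInstance

theorem full_souriauRestriction_chenJoinExtension :
    (souriauRestriction.{u}.functor ⋙ chenJoinExtension.functor).Full :=
  have := isRestrictionExtensionIso_souriau.{u}.full_restriction
  have : chenJoinExtension.{u}.functor.Full :=
    full_of_restrict_obj (restrict_diffeologicalJoin _ _)
  inferInstance

/-- The left adjoint of the functor from Chen spaces to Souriau spaces. -/
def chenMeetAdjunction :
    souriauRestriction.{u}.functor ⋙ chenMeetExtension.functor ⊣
      chenRestriction.functor ⋙ souriauExtension.functor :=
  isRestrictionExtensionIso_souriau.equivalence.toAdjunction.comp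
    (diffeologicalMeetAdjunction curveDetermined_of_mem_convexTests _ hasSmallCuts_convexTests)

/-- The right adjoint of the functor from Chen spaces to Souriau spaces. -/
def chenJoinAdjunction :
    chenRestriction.functor ⋙ souriauExtension.functor ⊣
      souriauRestriction.{u}.functor ⋙ chenJoinExtension.functor :=
  (diffeologicalJoinAdjunction curveDetermined_of_mem_convexTests _).comp
    isRestrictionExtensionIso_souriau.equivalence.symm.toAdjunction

/-- Restriction of Frölicher spaces with open test spaces to the real line. -/
def frolicherRestriction : FibreFunctor frolicherOpen.{u} frolicher.{u} :=
  saturatedRestriction rfl curveDetermined_of_mem_openTests line_subset_open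

/-- The extension of Frölicher spaces from the real line to the open test spaces. -/
def frolicherExtension : FibreFunctor frolicher.{u} frolicherOpen.{u} :=
  saturatedExtension rfl curveDetermined_of_mem_openTests line_subset_open

theorem isRestrictionExtensionIso_frolicher :
    frolicherRestriction.{u}.IsRestrictionExtensionIso frolicherExtension line_subset_open :=
  isRestrictionExtensionIso_saturated (𝒮 := lineTests) rfl curveDetermined_of_mem_openTests
    line_subset_open

theorem frolicherOpen_le_souriau : InSat ⊓ OutSat ≤ souriau.{u} := fun _ _ _ hV =>
  ⟨⟨InSat.inSheaf hV.1, InSat.inTerm (line_subset_open rfl) hV.1⟩, hV.2⟩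

/-- The inclusion of Frölicher spaces in Souriau spaces. -/
def frolicherInclusion : FibreFunctor frolicherOpen.{u} souriau.{u} :=
  inclusion _ _ frolicherOpen_le_souriau

/-- The meet forcing functor from Souriau spaces to Frölicher spaces. -/
def frolicherMeetForcing : FibreFunctor souriau.{u} frolicherOpen.{u} :=
  meetForcing _ fun _ _ _ hV => hV.2

theorem isMeetForcing_frolicherMeetForcing : frolicherMeetForcing.{u}.IsMeetForcing :=
  isMeetForcing_meetForcing _ _

theorem full_frolicherExtension_inclusion :
    (frolicherExtension.{u}.functor ⋙ frolicherInclusion.functor).Full :=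
  have := isRestrictionExtensionIso_frolicher.{u}.full_extension
  have : frolicherInclusion.{u}.functor.Full := full_inclusion _ _ _
  inferInstance

/-- The left adjoint of the embedding of Frölicher spaces in Souriau spaces. -/
def frolicherMeetAdjunction :
    frolicherMeetForcing.{u}.functor ⋙ frolicherRestriction.functor ⊣
      frolicherExtension.functor ⋙ frolicherInclusion.functor :=
  (meetForcingAdjunction souriau (fun _ _ _ hV => hV.2) frolicherOpen_le_souriau).comp
    isRestrictionExtensionIso_frolicher.equivalence.toAdjunction

end Diffeological

/-! ### Smith and Sikorski spaces -/

section Smith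

open FibreFunctor

/-- Restriction of Smith spaces with Euclidean test spaces to the real line. -/
def smithRestriction : FibreFunctor smithEuclidean.{u} smith.{u} :=
  saturatedRestriction rfl (fun _ => curveDetermined_of_mem_euclideanTests) line_subset_euclidean

/-- The extension of Smith spaces from the real line to all Euclidean spaces. -/
def smithExtension : FibreFunctor smith.{u} smithEuclidean.{u} :=
  saturatedExtension rfl (fun _ => curveDetermined_of_mem_euclideanTests) line_subset_euclidean

theorem isRestrictionExtensionIso_smith :
    smithRestriction.{u}.IsRestrictionExtensionIso smithExtension line_subset_euclidean :=
  isRestrictionExtensionIso_saturated (𝒮 := lineTests) rfl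
    (fun _ => curveDetermined_of_mem_euclideanTests) line_subset_euclidean

theorem smithEuclidean_le_sikorski : InSat ⊓ OutSat ≤ sikorski.{u} := fun _ _ _ hV =>
  ⟨hV.1, ⟨OutSat.outSheaf hV.2, OutSat.outDetCoord line_subset_euclidean hV.2⟩,
    OutSat.outTerm (line_subset_euclidean rfl) hV.2⟩

/-- The inclusion of Smith spaces in Sikorski spaces. -/
def smithInclusion : FibreFunctor smithEuclidean.{u} sikorski.{u} :=
  inclusion _ _ smithEuclidean_le_sikorski

/-- The join forcing functor from Sikorski spaces to Smith spaces. -/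
def smithJoinForcing : FibreFunctor sikorski.{u} smithEuclidean.{u} :=
  joinForcing _ fun _ _ _ hV => hV.1

theorem isJoinForcing_smithJoinForcing : smithJoinForcing.{u}.IsJoinForcing :=
  isJoinForcing_joinForcing _ _

theorem full_smithExtension_inclusion :
    (smithExtension.{u}.functor ⋙ smithInclusion.functor).Full :=
  have := isRestrictionExtensionIso_smith.{u}.full_extension
  have : smithInclusion.{u}.functor.Full := full_inclusion _ _ _
  inferInstance

/-- The right adjoint of the embedding of Smith spaces in Sikorski spaces. -/
def smithJoinAdjunction :
    smithExtension.{u}.functor ⋙ smithInclusion.functor ⊣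
      smithJoinForcing.functor ⋙ smithRestriction.functor :=
  isRestrictionExtensionIso_smith.equivalence.symm.toAdjunction.comp
    (joinForcingAdjunction sikorski (fun _ _ _ hV => hV.1) smithEuclidean_le_sikorski)

end Smith

/-! ### Frölicher spaces as Smith spaces -/

section FrolicherSmith

theorem str_smithToFrolicher_withTopology (A : Space frolicher.{u})
    (t : TopologicalSpace A.carrier) (hi : ∀ S, ∀ i ∈ A.str.inp S, @Continuous _ _ _ t i)
    (ho : ∀ S, ∀ o ∈ A.str.out S, @Continuous _ _ t _ o) :
    (smithToFrolicher.obj (Frolicher.withTopology A t hi ho)).str = A.str := by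
  have mem_inp (S : lineTests) (i : S.1 → A.carrier) :
      (∀ T, ∀ o ∈ A.str.out T, IsSmooth (o ∘ i)) ↔ i ∈ A.str.inp S :=
    ⟨A.prop.1 S i trivial, fun hi _ _ ho => A.str.compat hi ho⟩
  have mem_out (T : lineTests) (o : A.carrier → T.1) :
      (∀ (S : lineTests) (i : S.1 → A.carrier),
        (∀ T', ∀ o' ∈ A.str.out T', IsSmooth (o' ∘ i)) → IsSmooth (o ∘ i)) ↔ o ∈ A.str.out T :=
    ⟨fun h => A.prop.2 T o trivial fun S i hi => h S i ((mem_inp S i).2 hi),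
      fun ho S i hi => hi T o ho⟩
  exact VirtualStr.ext (funext fun S => Set.ext (mem_inp S)) (funext fun T => Set.ext (mem_out T))

/-- The composite functor from Frölicher spaces through Smith spaces to Frölicher spaces. -/
def frolicherRoundTrip : FibreFunctor frolicher.{u} frolicher.{u} where
  obj X b V :=
    let A := (frolicherToSmithCurvaceous ⋙ smithToFrolicher).obj ⟨X, b, V.1, V.2⟩
    ⟨A.str, A.prop⟩
  map X Y b c V W f hf := ((frolicherToSmithCurvaceous ⋙ smithToFrolicher).map
    (X := ⟨X, b, V.1, V.2⟩) (Y := ⟨Y, c, W.1, W.2⟩) ⟨f, hf⟩).isMor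

theorem functor_frolicherRoundTrip : frolicherRoundTrip.{u}.functor = 𝟭 (Space frolicher.{u}) :=
  FibreFunctor.functor_eq_id _ fun X b V =>
    Subtype.ext (str_smithToFrolicher_withTopology ⟨X, b, V.1, V.2⟩ _ _ _)

theorem frolicherToSmithCurvaceous_comp_smithToFrolicher :
    frolicherToSmithCurvaceous.{u} ⋙ smithToFrolicher = 𝟭 (Space frolicher.{u}) :=
  functor_frolicherRoundTrip

theorem frolicherToSmithFunctional_comp_smithToFrolicher :
    frolicherToSmithFunctional.{u} ⋙ smithToFrolicher = 𝟭 (Space frolicher.{u}) :=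
  functor_frolicherRoundTrip

theorem full_frolicherToSmithCurvaceous : frolicherToSmithCurvaceous.{u}.Full :=
  ⟨fun g => ⟨⟨g.toFun, trivial, g.isMor.2⟩, rfl⟩⟩

theorem full_frolicherToSmithFunctional : frolicherToSmithFunctional.{u}.Full :=
  ⟨fun g => ⟨⟨g.toFun, trivial, g.isMor.2⟩, rfl⟩⟩

theorem faithful_frolicherToSmithCurvaceous : frolicherToSmithCurvaceous.{u}.Faithful :=
  ⟨fun h => Space.Hom.ext (congrArg (fun g => g.toFun) h)⟩

theorem faithful_frolicherToSmithFunctional : frolicherToSmithFunctional.{u}.Faithful :=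
  ⟨fun h => Space.Hom.ext (congrArg (fun g => g.toFun) h)⟩

end FrolicherSmith

/-! ### Determined inputs -/

section DeterminedHull

variable {B : Underlying.{u}} [B.IsRegular] {𝒯 : Set TestSpace} {X : Type u} {b : B.Str X}
  {V W : VirtualStr B 𝒯 b}

open Underlying.IsRegular

theorem InSat.inDet (hV : InSat b V) : InDet b V := fun S _ hF i hi hdet =>
  hV S i hi fun T _ ho => hF.2 T _ (in_out hi (V.out_mor T ho)) fun R t ht =>
    V.compat (hdet R t ht) ho

/-- The maps from test spaces which are generated by the inputs of `V` under composition with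
smooth maps and the rule of the input determined condition. -/
inductive IsDeterminedInput (V : VirtualStr B 𝒯 b) : ∀ S : 𝒯, (S.1 → X) → Prop
  | of_mem {S : 𝒯} {i : S.1 → X} : i ∈ V.inp S → IsDeterminedInput V S i
  | comp {S T : 𝒯} {i : T.1 → X} {f : S.1 → T.1} : IsSmooth f → IsDeterminedInput V T i →
      IsDeterminedInput V S (i ∘ f)
  | of_isDetermining {S : 𝒯} {i : S.1 → X} (F : ∀ T : 𝒯, Set (T.1 → S.1)) :
      IsDetermining B 𝒯 S.1 F → i ∈ B.inMor b S.1 →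
      (∀ T, ∀ t ∈ F T, IsDeterminedInput V T (i ∘ t)) → IsDeterminedInput V S i

namespace IsDeterminedInput

variable {S : 𝒯} {i : S.1 → X}

theorem mem_inMor (hi : IsDeterminedInput V S i) : i ∈ B.inMor b S.1 := by
  induction hi with
  | of_mem hi => exact V.inp_mor _ hi
  | comp hf _ ih => exact in_comp hf ih
  | of_isDetermining _ _ hi _ _ => exact hi

theorem isSmooth_comp (hi : IsDeterminedInput V S i) {T : 𝒯} {o : X → T.1} (ho : o ∈ V.out T) :
    IsSmooth (o ∘ i) := by
  induction hi with
  | of_mem hi => exact V.compat hi ho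
  | comp hf _ ih => exact ih.comp hf
  | of_isDetermining F hF hi _ ih => exact hF.2 T _ (in_out hi (V.out_mor T ho)) ih

theorem mem_inp {Y : Type u} {c : B.Str Y} {W : VirtualStr B 𝒯 c} {f : X → Y} (hW : InDet c W)
    (hf : IsMor V W f) (hi : IsDeterminedInput V S i) : f ∘ i ∈ W.inp S := by
  induction hi with
  | of_mem hi => exact hf.2.1 _ _ hi
  | comp hg _ ih => exact W.inp_comp hg ih
  | of_isDetermining F hF hi _ ih => exact hW _ F hF _ (mor_in hf.1 hi) ih

end IsDeterminedInput

/-- The structure with the outputs of `V` and the inputs generated by those of `V`. -/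
def determinedHull (V : VirtualStr B 𝒯 b) : VirtualStr B 𝒯 b where
  inp S := {i | IsDeterminedInput V S i}
  out := V.out
  inp_mor _ _ hi := hi.mem_inMor
  out_mor := V.out_mor
  inp_comp hf hi := .comp hf hi
  out_comp := V.out_comp
  compat hi ho := hi.isSmooth_comp ho

theorem le_determinedHull (V : VirtualStr B 𝒯 b) : V ≤ determinedHull V :=
  ⟨fun _ _ hi => .of_mem hi, fun _ => subset_rfl⟩

theorem inDet_determinedHull (V : VirtualStr B 𝒯 b) : InDet b (determinedHull V) :=
  fun _ F hF _ hi hdet => .of_isDetermining F hF hi hdet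

theorem IsMor.determinedHull {Y : Type u} {c : B.Str Y} {W : VirtualStr B 𝒯 c} {f : X → Y}
    (hW : InDet c W) (hf : IsMor V W f) : IsMor (determinedHull V) W f :=
  ⟨hf.1, fun _ _ hi => hi.mem_inp hW hf, hf.2.2⟩

end DeterminedHull

/-! ### The earlier categories of Chen spaces -/

section Chen1975

open FibreFunctor

theorem chen1975b_le_chen1975a : chen1975b.{u} ≤ chen1975a := fun _ _ _ hV => ⟨hV.1.2, hV.2⟩

/-- The inclusion between the two categories of Chen spaces of 1975. -/
def chen1975Inclusion : FibreFunctor chen1975b.{u} chen1975a.{u} :=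
  inclusion _ _ chen1975b_le_chen1975a

theorem chen1975b_determinedHull ⦃X : Type u⦄ (b : topologicalSpaces.Str X)
    (V : VirtualStr topologicalSpaces closedConvexTests b) (hV : chen1975a b V) :
    chen1975b b (determinedHull V) :=
  have hle := le_determinedHull V
  ⟨⟨inDet_determinedHull V, fun S hS _ hi => hle.1 S (hV.1 S hS hi)⟩,
    fun T o ho hsmooth => hV.2 T o ho fun S i hi => hsmooth S i (hle.1 S hi)⟩

/-- The functor which makes the inputs determined. -/
def chen1975Reflection : FibreFunctor chen1975a.{u} chen1975b.{u} where
  obj _ b V := ⟨determinedHull V.1, chen1975b_determinedHull b V.1 V.2⟩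
  map _ _ _ _ _ W _ hf := IsMor.determinedHull (inDet_determinedHull W.1)
    ⟨hf.1, fun S i hi => (le_determinedHull W.1).1 S (hf.2.1 S i hi), hf.2.2⟩

/-- Making the inputs determined is left adjoint to the inclusion. -/
def chen1975Adjunction : chen1975Reflection.{u}.functor ⊣ chen1975Inclusion.functor :=
  FibreFunctor.adjunction _ _ (fun _ _ V => le_determinedHull V.1) fun _ _ W =>
    ((isMor_id_of_le (le_refl W.1)).determinedHull W.2.1.1).2

theorem curveDetermined_of_mem_closedConvexTests :
    ∀ T ∈ closedConvexTests, CurveDetermined T :=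
  fun _ hT => curveDetermined_of_convex hT.2

theorem sat_le_chen1975b : InSat ⊓ OutSat ≤ chen1975b.{u} := fun _ _ _ hV =>
  ⟨⟨InSat.inDet hV.1, InSat.inTerm (line_subset_closedConvex rfl) hV.1⟩, hV.2⟩

/-- The join extension of Smith spaces to closed convex test spaces. -/
def smithChenExtension : FibreFunctor smith.{u} chen1975b.{u} :=
  probeExtension (𝒮 := lineTests) rfl curveDetermined_of_mem_closedConvexTests fun _ b _ hV =>
    sat_le_chen1975b _ b _ ⟨InSat.probe _ _ line_subset_closedConvex hV.1,
      outSat_probe _ _ line_subset_closedConvex⟩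

theorem isJoinExtension_smithChenExtension :
    smithChenExtension.{u}.IsJoinExtension line_subset_closedConvex :=
  isJoinExtension_probeExtension _ _ _ _ fun _ _ _ hV => hV.2

theorem full_smithChenExtension : smithChenExtension.{u}.functor.Full :=
  full_probeExtension _ _ _ line_subset_closedConvex fun _ _ _ hV => hV.2

theorem isRightAdjoint_smithChenExtension : smithChenExtension.{u}.functor.IsRightAdjoint :=
  ⟨_, ⟨(meetForcingAdjunction chen1975b (fun _ _ _ hV => hV.2) sat_le_chen1975b).comp
    (isRestrictionExtensionIso_saturated (𝒮 := lineTests) rfl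
      curveDetermined_of_mem_closedConvexTests
      line_subset_closedConvex).equivalence.toAdjunction⟩⟩

end Chen1975

section Chen1973

open Topology

variable {𝒯 : Set TestSpace} {X : Type u} [t : TopologicalSpace X]

theorem isQuotientMap_t2Quotient_mk : IsQuotientMap (T2Quotient.mk : X → T2Quotient X) :=
  isQuotientMap_quot_mk

/-- The quotient structure on the largest Hausdorff quotient. -/
def t2QuotientStr (V : VirtualStr topologicalSpaces 𝒯 t) :
    VirtualStr hausdorffSpaces 𝒯 (X := T2Quotient X) ⟨inferInstance, inferInstance⟩ where
  inp S := {k | ∃ i ∈ V.inp S, T2Quotient.mk ∘ i = k}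
  out T := {o | o ∘ T2Quotient.mk ∈ V.out T}
  inp_mor := by
    rintro S _ ⟨i, hi, rfl⟩
    exact (T2Quotient.continuous_mk X).comp (V.inp_mor S hi)
  out_mor T _ ho := isQuotientMap_t2Quotient_mk.continuous_iff.2 (V.out_mor T ho)
  inp_comp := by
    rintro S T f _ hf ⟨i, hi, rfl⟩
    exact ⟨i ∘ f, V.inp_comp hf hi, rfl⟩
  out_comp hf ho := V.out_comp hf ho
  compat := by
    rintro S T _ o ⟨i, hi, rfl⟩ ho
    exact V.compat hi ho

variable {V : VirtualStr topologicalSpaces 𝒯 t}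

theorem isMor_t2QuotientStr_iff {Y : Type u} {c : hausdorffSpaces.Str Y}
    {W : VirtualStr hausdorffSpaces 𝒯 c} {g : T2Quotient X → Y} :
    IsMor (t2QuotientStr V) W g ↔ @Continuous _ _ _ c.1 (g ∘ T2Quotient.mk) ∧
      (∀ S, ∀ i ∈ V.inp S, (g ∘ T2Quotient.mk) ∘ i ∈ W.inp S) ∧
      ∀ T, ∀ o ∈ W.out T, o ∘ g ∘ T2Quotient.mk ∈ V.out T := by
  let _ : TopologicalSpace Y := c.1
  refine and_congr isQuotientMap_t2Quotient_mk.continuous_iff (and_congr_left' ?_)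
  exact forall_congr' fun S => Set.forall_mem_image

theorem InTerm.t2QuotientStr (hline : realLine ∈ 𝒯) (hV : InTerm (B := topologicalSpaces) t V) :
    InTerm (B := hausdorffSpaces) _ (t2QuotientStr V) := fun S hS k _ => by
  have := hS.subsingleton hline
  obtain ⟨s⟩ := hS.nonempty hline
  obtain ⟨x, hx⟩ := T2Quotient.surjective_mk X (k s)
  refine ⟨fun _ => x, hV S hS continuous_const, funext fun r => ?_⟩
  exact hx.trans (congrArg k (Subsingleton.elim s r))

theorem OutSat.t2QuotientStr (hV : OutSat (B := topologicalSpaces) t V) :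
    OutSat (B := hausdorffSpaces) _ (t2QuotientStr V) := fun T _ ho hsmooth =>
  hV T _ (isQuotientMap_t2Quotient_mk.continuous_iff.1 ho) fun S i hi => hsmooth S _ ⟨i, hi, rfl⟩

/-- The Hausdorff quotient of a Chen space. -/
def hausdorffQuotient (A : Space chen1975a.{u}) : Space chen1973.{u} :=
  letI : TopologicalSpace A.carrier := A.base
  ⟨T2Quotient A.carrier, _, t2QuotientStr A.str,
    InTerm.t2QuotientStr (line_subset_closedConvex rfl) A.prop.1, OutSat.t2QuotientStr A.prop.2⟩

/-- The universal property of the Hausdorff quotient. -/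
def hausdorffQuotientEquiv (A : Space chen1975a.{u}) (Z : Space chen1973.{u}) :
    (hausdorffQuotient A ⟶ Z) ≃ (A ⟶ chen1973Inclusion.obj Z) :=
  letI : TopologicalSpace A.carrier := A.base
  { toFun g := ⟨g.toFun ∘ T2Quotient.mk, isMor_t2QuotientStr_iff.1 g.isMor⟩
    invFun f :=
      ⟨@T2Quotient.lift _ Z.carrier A.base Z.base.1 Z.base.2 f.toFun f.isMor.1,
        isMor_t2QuotientStr_iff.2 f.isMor⟩
    left_inv _ := Space.Hom.ext (funext fun q => q.inductionOn fun _ => rfl)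
    right_inv _ := rfl }

theorem isRightAdjoint_chen1973Inclusion : chen1973Inclusion.{u}.IsRightAdjoint :=
  ⟨_, ⟨Adjunction.adjunctionOfEquivLeft hausdorffQuotientEquiv fun _ _ _ _ _ => rfl⟩⟩

theorem full_chen1973Inclusion : chen1973Inclusion.{u}.Full :=
  ⟨fun g => ⟨⟨g.toFun, g.isMor⟩, rfl⟩⟩

theorem faithful_chen1973Inclusion : chen1973Inclusion.{u}.Faithful :=
  ⟨fun h => Space.Hom.ext (congrArg (fun g => g.toFun) h)⟩

end Chen1973

end SmoothSpaces

theorem mainTheorem10 :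
    -- Frölicher spaces, Souriau spaces and Chen spaces (over sets).
    (∃ (resF : FibreFunctor frolicherOpen.{u} frolicher.{u})
      (extF : FibreFunctor frolicher.{u} frolicherOpen.{u})
      (resD : FibreFunctor souriau.{u} souriauConvex.{u})
      (extD : FibreFunctor souriauConvex.{u} souriau.{u})
      (incF : FibreFunctor frolicherOpen.{u} souriau.{u})
      (meetF : FibreFunctor souriau.{u} frolicherOpen.{u})
      (resC : FibreFunctor chen.{u} souriauConvex.{u})
      (meetC joinC : FibreFunctor souriauConvex.{u} chen.{u}),
      -- Restriction and extension are isomorphisms of categories.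
      resF.IsRestrictionExtensionIso extF line_subset_open ∧
      resD.IsRestrictionExtensionIso extD Set.inter_subset_left ∧
      -- Frölicher spaces are a full reflective subcategory of Souriau spaces.
      incF.IsInclusion ∧ meetF.IsMeetForcing ∧
      (extF.functor ⋙ incF.functor).Full ∧ (extF.functor ⋙ incF.functor).Faithful ∧
      Nonempty (meetF.functor ⋙ resF.functor ⊣ extF.functor ⋙ incF.functor) ∧
      -- Restriction from Chen spaces to Souriau spaces has both adjoints, which are embeddings.
      resC.IsRestriction Set.inter_subset_right ∧
      meetC.IsMeetExtension Set.inter_subset_right ∧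
      joinC.IsJoinExtension Set.inter_subset_right ∧
      (resD.functor ⋙ meetC.functor).Full ∧ (resD.functor ⋙ meetC.functor).Faithful ∧
      (resD.functor ⋙ joinC.functor).Full ∧ (resD.functor ⋙ joinC.functor).Faithful ∧
      Nonempty (resD.functor ⋙ meetC.functor ⊣ resC.functor ⋙ extD.functor) ∧
      Nonempty (resC.functor ⋙ extD.functor ⊣ resD.functor ⋙ joinC.functor)) ∧
    -- Smith spaces and Sikorski spaces (over topological spaces).
    (∃ (resS : FibreFunctor smithEuclidean.{u} smith.{u})
      (extS : FibreFunctor smith.{u} smithEuclidean.{u})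
      (incS : FibreFunctor smithEuclidean.{u} sikorski.{u})
      (joinS : FibreFunctor sikorski.{u} smithEuclidean.{u}),
      resS.IsRestrictionExtensionIso extS line_subset_euclidean ∧
      -- Smith spaces are a full coreflective subcategory of Sikorski spaces.
      incS.IsInclusion ∧ joinS.IsJoinForcing ∧
      (extS.functor ⋙ incS.functor).Full ∧ (extS.functor ⋙ incS.functor).Faithful ∧
      Nonempty (extS.functor ⋙ incS.functor ⊣ joinS.functor ⋙ resS.functor)) ∧
    -- The two embeddings of Frölicher spaces in Smith spaces, with their common left inverse.
    (frolicherToSmithCurvaceous.{u}.Full ∧ frolicherToSmithCurvaceous.{u}.Faithful ∧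
      frolicherToSmithCurvaceous.{u} ⋙ smithToFrolicher = 𝟭 (Space frolicher.{u}) ∧
      frolicherToSmithFunctional.{u}.Full ∧ frolicherToSmithFunctional.{u}.Faithful ∧
      frolicherToSmithFunctional.{u} ⋙ smithToFrolicher = 𝟭 (Space frolicher.{u})) ∧
    -- The three earlier categories of Chen spaces.
    (∃ (incK : FibreFunctor chen1975b.{u} chen1975a.{u})
      (extK : FibreFunctor smith.{u} chen1975b.{u}),
      chen1973Inclusion.{u}.Full ∧ chen1973Inclusion.{u}.Faithful ∧
      chen1973Inclusion.{u}.IsRightAdjoint ∧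
      incK.IsInclusion ∧ incK.functor.Full ∧ incK.functor.Faithful ∧
      incK.functor.IsRightAdjoint ∧
      extK.IsJoinExtension line_subset_closedConvex ∧
      extK.functor.Full ∧ extK.functor.Faithful ∧ extK.functor.IsRightAdjoint) :=
  ⟨⟨frolicherRestriction, frolicherExtension, souriauRestriction, souriauExtension,
      frolicherInclusion, frolicherMeetForcing, chenRestriction, chenMeetExtension,
      chenJoinExtension, isRestrictionExtensionIso_frolicher, isRestrictionExtensionIso_souriau,
      fun _ _ _ => rfl, isMeetForcing_frolicherMeetForcing, full_frolicherExtension_inclusion,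
      (frolicherExtension.comp frolicherInclusion).faithful, ⟨frolicherMeetAdjunction⟩,
      fun _ _ _ => rfl, isMeetExtension_chenMeetExtension, isJoinExtension_chenJoinExtension,
      full_souriauRestriction_chenMeetExtension,
      (souriauRestriction.comp chenMeetExtension).faithful,
      full_souriauRestriction_chenJoinExtension,
      (souriauRestriction.comp chenJoinExtension).faithful, ⟨chenMeetAdjunction⟩,
      ⟨chenJoinAdjunction⟩⟩,
    ⟨smithRestriction, smithExtension, smithInclusion, smithJoinForcing,
      isRestrictionExtensionIso_smith, fun _ _ _ => rfl, isJoinForcing_smithJoinForcing,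
      full_smithExtension_inclusion, (smithExtension.comp smithInclusion).faithful,
      ⟨smithJoinAdjunction⟩⟩,
    ⟨full_frolicherToSmithCurvaceous, faithful_frolicherToSmithCurvaceous,
      frolicherToSmithCurvaceous_comp_smithToFrolicher, full_frolicherToSmithFunctional,
      faithful_frolicherToSmithFunctional, frolicherToSmithFunctional_comp_smithToFrolicher⟩,
    ⟨chen1975Inclusion, smithChenExtension, full_chen1973Inclusion, faithful_chen1973Inclusion,
      isRightAdjoint_chen1973Inclusion, fun _ _ _ => rfl, FibreFunctor.full_inclusion _ _ _,
      chen1975Inclusion.faithful, chen1975Adjunction.isRightAdjoint,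
      isJoinExtension_smithChenExtension, full_smithChenExtension, smithChenExtension.faithful,
      isRightAdjoint_smithChenExtension⟩⟩
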